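/- Let $G$ be a compact Lie group with Lie algebra $\mathfrak g$, let $\cdot$ be an $\mathrm{Ad}$-invariant inner product on $\mathfrak g$, and let $(e_a)$ be an orthonormal basis of $\mathfrak g$, with structure constants $f_{abc}=e_a\cdot[e_b,e_c]$. For $\xi\in\mathfrak g$ let $\xi^L,\xi^R$ be the left- and right-invariant vector fields on $G$ with value $\xi$ at the identity; the components of a linear map $A:\mathfrak g\to\mathfrak g$ are $A_{ab}=e_a\cdot Ae_b$, and sums over repeated indices are understood. Let $g\in G$, let $H=G_g$ be its stabilizer under conjugation, $\mathfrak h=\mathrm{Lie}(H)\subset\mathfrak g$, and let $U$ be a slice at $g$: a connected open neighbourhood of $g$ in $H$ such that the natural map $G\times_H U\to G$, $[k,u]\mapsto kuk^{-1}$, is a diffeomorphism onto its (open) image. For a vector field $X$ on $G$ along $U$ let $X_{\mathfrak h}$ be its orthogonal projection (for the bi-invariant metric on $G$) to a vector field tangent to $U$. Let $f^{\mathfrak h}_{abc}$ be the structure constants of $\mathfrak h$, viewed as the components of a tensor in $\wedge^3\mathfrak g$ under the inclusion $\wedge^3\mathfrak h\to\wedge^3\mathfrak g$; that is, $f^{\mathfrak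 h}_{abc}=p e_a\cdot[p e_b,p e_c]$ with $p:\mathfrak g\to\mathfrak h$ the orthogonal projection. Then for every $u\in U$ the operator $\mathrm{Ad}_u-1$ maps $\mathfrak h^\perp$ bijectively onto itself; the functions $$ r_{ab}(u)=-\frac12\Big(\frac{\mathrm{Ad}_u+1}{\mathrm{Ad}_u-1}\Big|_{\mathfrak h^\perp}\Big)_{ab} $$ (the operator on $\mathfrak h^\perp$ being extended by zero on $\mathfrak h$) are smooth on $U$; and on $U$, for all $a,b,c$, $$ \mathrm{Cycl}_{abc}\Big(\tfrac12(e_a^L+e_a^R)_{\mathfrak h}\,r_{bc}+r_{ak}f_{kbl}r_{lc}\Big)=\tfrac14\big(f_{abc}-f^{\mathfrak h}_{abc}\big), $$ where $\mathrm{Cycl}_{abc}$ denotes the sum over the cyclic permutations of $(a,b,c)$. -/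

import Mathlib

open scoped Manifold ContDiff

noncomputable section

section LieGroupNotions

variable {n : ℕ} {G : Type*} [TopologicalSpace G] [ChartedSpace (EuclideanSpace ℝ (Fin n)) G]
  [Group G]

/-- `Ad_k`, the differential at the identity of the conjugation `x ↦ k x k⁻¹`. -/
def lieAd (k : G) : Module.End ℝ (GroupLieAlgebra (𝓡 n) G) :=
  ContinuousLinearMap.toLinearMap (M := GroupLieAlgebra (𝓡 n) G) (M₂ := GroupLieAlgebra (𝓡 n) G)
    (mfderiv (𝓡 n) (𝓡 n) (fun x : G => k * x * k⁻¹) 1)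

/-- The right-invariant vector field `ξ^R` with value `ξ` at the identity. (The left-invariant
one, `ξ^L`, is Mathlib's `mulInvariantVectorField ξ`.) -/
def rightInvariantVectorField (ξ : GroupLieAlgebra (𝓡 n) G) (u : G) : TangentSpace (𝓡 n) u :=
  mfderiv (𝓡 n) (𝓡 n) (fun x : G => x * u) 1 ξ

/-- `ξ` is the velocity at time `0` of a smooth (germ of a) curve in `K` through the identity. -/
def IsVelocityAtOne (K : Subgroup G) (ξ : GroupLieAlgebra (𝓡 n) G) : Prop :=
  ∃ γ : ℝ → G, γ 0 = 1 ∧ ContMDiffAt 𝓘(ℝ, ℝ) (𝓡 n) ∞ γ 0 ∧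
    (∀ᶠ t in nhds (0 : ℝ), γ t ∈ K) ∧
    (mfderiv 𝓘(ℝ, ℝ) (𝓡 n) γ 0 (1 : ℝ) : EuclideanSpace ℝ (Fin n)) = ξ

theorem isVelocityAtOne_zero (K : Subgroup G) :
    IsVelocityAtOne K (0 : GroupLieAlgebra (𝓡 n) G) := by
  refine ⟨fun _ => 1, rfl, contMDiffAt_const, Filter.Eventually.of_forall fun _ => K.one_mem, ?_⟩
  rw [mfderiv_const]
  rfl

theorem isVelocityAtOne_smul (K : Subgroup G) (c : ℝ) {ξ : GroupLieAlgebra (𝓡 n) G}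
    (h : IsVelocityAtOne K ξ) : IsVelocityAtOne K (c • ξ) := by
  obtain ⟨γ, h1, hs, hK, hd⟩ := h
  have h0 : c * (0 : ℝ) = 0 := mul_zero c
  have hc : ContMDiffAt 𝓘(ℝ, ℝ) 𝓘(ℝ, ℝ) ∞ (fun t : ℝ => c * t) 0 :=
    (contDiffAt_const.mul contDiffAt_id).contMDiffAt
  refine ⟨γ ∘ fun t => c * t, by simp [h1], ContMDiffAt.comp_of_eq hs hc h0, ?_, ?_⟩
  · have ht : Filter.Tendsto (fun t : ℝ => c * t) (nhds 0) (nhds 0) := by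
      have := hc.continuousAt
      rw [ContinuousAt, h0] at this
      exact this
    exact ht.eventually hK
  · rw [mfderiv_comp_of_eq (hs.mdifferentiableAt (by simp)) (hc.mdifferentiableAt (by simp)) h0]
    have hm : mfderiv 𝓘(ℝ, ℝ) 𝓘(ℝ, ℝ) (fun t : ℝ => c * t) 0 (1 : ℝ) = c := by
      rw [mfderiv_eq_fderiv]
      have : HasDerivAt (fun t : ℝ => c * t) c 0 := by
        simpa using (hasDerivAt_id (0 : ℝ)).const_mul c
      exact this.deriv
    have e : (c : ℝ) = c • (1 : ℝ) := by simp
    subst hd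
    have key : ∀ s : ℝ, s = 0 →
        (mfderiv 𝓘(ℝ, ℝ) (𝓡 n) γ s (c • (1 : ℝ)) : EuclideanSpace ℝ (Fin n)) =
          c • (mfderiv 𝓘(ℝ, ℝ) (𝓡 n) γ 0 (1 : ℝ) : EuclideanSpace ℝ (Fin n)) := by
      rintro s rfl
      exact (mfderiv 𝓘(ℝ, ℝ) (𝓡 n) γ 0).map_smul c (1 : ℝ)
    exact (congrArg (mfderiv 𝓘(ℝ, ℝ) (𝓡 n) γ (c * 0)) (hm.trans e)).trans (key _ h0)

theorem isVelocityAtOne_add [LieGroup (𝓡 n) ∞ G] (K : Subgroup G) {ξ η : GroupLieAlgebra (𝓡 n) G}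
    (hξ : IsVelocityAtOne K ξ) (hη : IsVelocityAtOne K η) : IsVelocityAtOne K (ξ + η) := by
  obtain ⟨γ, h1, hs, hK, hd⟩ := hξ
  obtain ⟨δ, h1', hs', hK', hd'⟩ := hη
  refine ⟨fun t => γ t * δ t, by simp [h1, h1'], hs.mul hs', ?_, ?_⟩
  · filter_upwards [hK, hK'] with t a b using K.mul_mem a b
  · have hm : MDifferentiableAt ((𝓡 n).prod (𝓡 n)) (𝓡 n) (fun p : G × G => p.1 * p.2)
        (γ 0, δ 0) := (contMDiff_mul (𝓡 n) ∞).mdifferentiable (by simp) _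
    have hg := hs.mdifferentiableAt (by simp)
    have hg' := hs'.mdifferentiableAt (by simp)
    have hc : (fun t => γ t * δ t) = (fun p : G × G => p.1 * p.2) ∘ fun t => (γ t, δ t) := rfl
    rw [hc, mfderiv_comp_of_eq hm (hg.prodMk hg') rfl, mfderiv_prodMk hg hg']
    subst hd hd'
    refine (mfderiv_prod_eq_add_apply hm).trans ?_
    have key : ∀ (φ : G → G) (x : G) (v : EuclideanSpace ℝ (Fin n)), φ = id →
        (mfderiv (𝓡 n) (𝓡 n) φ x v : EuclideanSpace ℝ (Fin n)) = v := by
      rintro φ x v rfl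
      rw [mfderiv_id]
      rfl
    exact congrArg₂ (fun x y : EuclideanSpace ℝ (Fin n) => x + y)
      (key (fun z : G => z * δ 0) (γ 0) _ (by ext; simp [h1']))
      (key (fun z : G => γ 0 * z) (δ 0) _ (by ext; simp [h1]))

/-- The Lie algebra of a closed subgroup `K` of the Lie group `G`, as a subspace of the Lie algebra
of `G`: the velocities at the identity of smooth curves in `K`. -/
def subgroupLie [LieGroup (𝓡 n) ∞ G] (K : Subgroup G) :
    Submodule ℝ (GroupLieAlgebra (𝓡 n) G) where
  carrier := {ξ | IsVelocityAtOne K ξ}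
  zero_mem' := isVelocityAtOne_zero K
  add_mem' := isVelocityAtOne_add K
  smul_mem' c _ h := isVelocityAtOne_smul K c h

/-- The stabilizer `H = G_g` of `g` under conjugation. -/
abbrev stab (g : G) : Subgroup G := Subgroup.centralizer {g}

/-- `U` is a slice at `g` for the conjugation action: a connected open neighbourhood of `g` in
`H = G_g` such that the natural map `G ×_H U → G`, `[k, u] ↦ k u k⁻¹`, is a diffeomorphism onto
its (open) image. The last two fields say that this map is injective and that its inverse is
smooth, i.e. lifts locally to smooth maps `w ↦ (κ w, υ w) ∈ G × U`, through any given
representative `(k, u)` (recall that `G × U → G ×_H U` is a submersion). -/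
structure IsConjSlice (g : G) (U : Set G) : Prop where
  subset_stab : U ⊆ stab g
  mem : g ∈ U
  open_in_stab : ∃ V : Set G, IsOpen V ∧ U = V ∩ stab g
  connected : IsConnected U
  injective : ∀ k₁ k₂ : G, ∀ u₁ ∈ U, ∀ u₂ ∈ U,
    k₁ * u₁ * k₁⁻¹ = k₂ * u₂ * k₂⁻¹ → ∃ h ∈ stab g, k₂ = k₁ * h⁻¹ ∧ u₂ = h * u₁ * h⁻¹
  smooth_inverse : ∀ k : G, ∀ u ∈ U, ∃ (W : Set G) (κ υ : G → G),
    IsOpen W ∧ k * u * k⁻¹ ∈ W ∧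
    ContMDiffOn (𝓡 n) (𝓡 n) ∞ κ W ∧ ContMDiffOn (𝓡 n) (𝓡 n) ∞ υ W ∧
    κ (k * u * k⁻¹) = k ∧ υ (k * u * k⁻¹) = u ∧
    ∀ w ∈ W, υ w ∈ U ∧ κ w * υ w * (κ w)⁻¹ = w

/-- An `Ad`-invariant inner product on the Lie algebra of `G`. -/
structure InvariantInnerProduct (n : ℕ) (G : Type*) [TopologicalSpace G]
    [ChartedSpace (EuclideanSpace ℝ (Fin n)) G] [Group G] where
  form : LinearMap.BilinForm ℝ (GroupLieAlgebra (𝓡 n) G)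
  symm : ∀ x y, form x y = form y x
  pos : ∀ x, x ≠ 0 → 0 < form x x
  invariant : ∀ (k : G) x y, form (lieAd k x) (lieAd k y) = form x y

namespace InvariantInnerProduct

variable (B : InvariantInnerProduct n G)

/-- The orthogonal complement of a subspace of the Lie algebra. -/
abbrev perp (W : Submodule ℝ (GroupLieAlgebra (𝓡 n) G)) :
    Submodule ℝ (GroupLieAlgebra (𝓡 n) G) := B.form.orthogonal W

theorem isCompl_perp (W : Submodule ℝ (GroupLieAlgebra (𝓡 n) G)) : IsCompl W (B.perp W) := by
  have : FiniteDimensional ℝ (GroupLieAlgebra (𝓡 n) G) :=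
    inferInstanceAs (FiniteDimensional ℝ (EuclideanSpace ℝ (Fin n)))
  have hr : B.form.IsRefl := fun x y h => by rw [B.symm, h]
  refine (LinearMap.BilinForm.isCompl_orthogonal_iff_disjoint hr).2 ?_
  rw [Submodule.disjoint_def]
  intro x hx hx'
  by_contra h0
  exact (B.pos x h0).ne' (hx' x hx)

/-- The orthogonal projection of the Lie algebra onto a subspace. -/
def proj (W : Submodule ℝ (GroupLieAlgebra (𝓡 n) G)) : Module.End ℝ (GroupLieAlgebra (𝓡 n) G) :=
  W.projection (B.perp W) (B.isCompl_perp W)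

/-- The orthogonal projection of the Lie algebra onto the orthogonal complement of a subspace. -/
def projPerp (W : Submodule ℝ (GroupLieAlgebra (𝓡 n) G)) :
    GroupLieAlgebra (𝓡 n) G →ₗ[ℝ] B.perp W :=
  (B.perp W).projectionOnto W (B.isCompl_perp W).symm

/-- An endomorphism of the Lie algebra that preserves `W^⊥`, seen as an endomorphism of `W^⊥`
(compression to `W^⊥` in general). -/
def onPerp (W : Submodule ℝ (GroupLieAlgebra (𝓡 n) G))
    (A : Module.End ℝ (GroupLieAlgebra (𝓡 n) G)) : Module.End ℝ (B.perp W) :=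
  B.projPerp W ∘ₗ A ∘ₗ (B.perp W).subtype

/-- The operator `-½ (Ad_u + 1)/(Ad_u - 1)` on `W^⊥`, extended by zero on `W`. -/
def rOperator (W : Submodule ℝ (GroupLieAlgebra (𝓡 n) G)) (u : G) :
    Module.End ℝ (GroupLieAlgebra (𝓡 n) G) :=
  (-(1 / 2 : ℝ)) • ((B.perp W).subtype ∘ₗ
    (B.onPerp W (lieAd u + 1) * Ring.inverse (B.onPerp W (lieAd u - 1))) ∘ₗ B.projPerp W)

variable {ι : Type*} (e : ι → GroupLieAlgebra (𝓡 n) G)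

/-- The components `r_{ab}(u) = e_a · r(u) e_b`. -/
def r (W : Submodule ℝ (GroupLieAlgebra (𝓡 n) G)) (a b : ι) (u : G) : ℝ :=
  B.form (e a) (B.rOperator W u (e b))

/-- The structure constants `f_{abc} = e_a · [e_b, e_c]`. -/
def f (a b c : ι) : ℝ := B.form (e a) ⁅e b, e c⁆

/-- The structure constants of a subalgebra `W`, as the components of a tensor on the whole Lie
algebra under the inclusion `∧³ W → ∧³ 𝔤`. -/
def fSub (W : Submodule ℝ (GroupLieAlgebra (𝓡 n) G)) (a b c : ι) : ℝ :=
  B.form (B.proj W (e a)) ⁅B.proj W (e b), B.proj W (e c)⁆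

/-- The orthogonal projection `T_uG → T_uU` for an open subset `U` of a coset of a closed subgroup
with Lie algebra `W`, so that `T_uU` is the left translate of `W`; orthogonality is with respect
to the (bi-)invariant metric on `G` defined by the inner product. -/
def tangentProj (W : Submodule ℝ (GroupLieAlgebra (𝓡 n) G)) (u : G)
    (X : TangentSpace (𝓡 n) u) : TangentSpace (𝓡 n) u :=
  mulInvariantVectorField (B.proj W (mfderiv (𝓡 n) (𝓡 n) (fun x : G => u⁻¹ * x) u X)) u

end InvariantInnerProduct

/-- The derivative `v F` at `u ∈ U` of a function `F` that is smooth on `U ⊆ G`, for a vector `v`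
tangent to `U` at `u` (only the values of `F` on `U` enter). -/
def derivAlong (U : Set G) (F : G → ℝ) (u : G) (v : TangentSpace (𝓡 n) u) : ℝ :=
  mfderivWithin (𝓡 n) 𝓘(ℝ, ℝ) F U u v

/-- The sum over cyclic permutations. -/
def cycl {ι : Type*} (F : ι → ι → ι → ℝ) (a b c : ι) : ℝ := F a b c + F b c a + F c a b

end LieGroupNotions

end

/-! Fix `u ∈ U` and write `A = Ad_u`. The slice property says that tangent directions of `U` and of
the conjugacy class of `u` together span, which makes `A - 1` surjective on `𝔥^⊥`. Since `A` is
orthogonal, a vector fixed by `A` is orthogonal to the range of `A - 1`, so `A - 1` is also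
injective there. Hence every vector has the form `x + (A a - a)` with `x ∈ 𝔥`, `a ∈ 𝔥^⊥`, and on it
`r` takes the value `-½ (A a + a)`: in these coordinates no inverse is left.

Write `e_i, e_j, e_k` in this form with pairs `(x,a)`, `(y,b)`, `(z,c)`, and let `Φ(x,y,z) =
x·[y,z]`, which is alternating and `A`-invariant. As `r` is antisymmetric, the quadratic term is
`-Φ(r e_i, e_j, r e_k)` (`sum_r_mul_f_mul_r`). Differentiating `r (A a - a) = -½ (A a + a)` along
`U`, with `d Ad = Ad ∘ ad`, turns the derivative term into `½ (Φ(x,b,c) + Φ(x,Ab,Ac))`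
(`derivAlong_r`).

What remains is multilinear algebra (`cyclic_sum_eq`). Mixed terms with two entries in `𝔥` vanish
because `[𝔥,𝔥^⊥] ⊆ 𝔥^⊥`; those with one entry in `𝔥` match identically; the term with three is
`f^𝔥`; and the term with none reduces to `Φ(Aa,Ab,Ac) = Φ(a,b,c)`.

The analytic input is that `Ad` is smooth with derivative the bracket at the identity
(`conjDerivDeriv_apply`), and that `r` extends smoothly to a neighbourhood in `G` of each point of
`U` (`contMDiffAt_cayleyExt`). -/

noncomputable section

namespace LieGroup

/-! ### The adjoint representation: multiplicativity and smoothness. -/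

section AdjointRepresentation

open VectorField

variable {n : ℕ} {G : Type*} [TopologicalSpace G] [ChartedSpace (EuclideanSpace ℝ (Fin n)) G]
  [Group G]

/-- The differential at the identity of the conjugation by `k`, as a continuous linear map of the
model space. -/
def conjDeriv (n : ℕ) {G : Type*} [TopologicalSpace G]
    [ChartedSpace (EuclideanSpace ℝ (Fin n)) G] [Group G] (k : G) :
    EuclideanSpace ℝ (Fin n) →L[ℝ] EuclideanSpace ℝ (Fin n) :=
  mfderiv (𝓡 n) (𝓡 n) (fun x : G => k * x * k⁻¹) 1

/-- The bracket lives on `GroupLieAlgebra`, the calculus on `EuclideanSpace`; the two are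
definitionally equal, and this passes between them. -/
theorem lieAd_apply (k : G) (ξ : GroupLieAlgebra (𝓡 n) G) : lieAd k ξ = conjDeriv n k ξ := rfl

theorem mfderiv_one_eq_fderiv {F : Type*} [NormedAddCommGroup F] [NormedSpace ℝ F] {f : G → F}
    (hf : MDifferentiableAt (𝓡 n) 𝓘(ℝ, F) f 1) :
    (mfderiv (𝓡 n) 𝓘(ℝ, F) f 1 : EuclideanSpace ℝ (Fin n) →L[ℝ] F) =
      fderiv ℝ (f ∘ (extChartAt (𝓡 n) (1 : G)).symm) (extChartAt (𝓡 n) (1 : G) 1) := by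
  refine hf.mfderiv.trans ?_
  rw [ModelWithCorners.range_eq_univ, fderivWithin_univ]
  rfl

/-- The composition rule, with the base point of the outer derivative given up to equality. -/
theorem mfderiv_comp_apply_of_base_eq {E₁ E₂ E₃ M₁ M₂ M₃ : Type*}
    [NormedAddCommGroup E₁] [NormedSpace ℝ E₁] [NormedAddCommGroup E₂] [NormedSpace ℝ E₂]
    [NormedAddCommGroup E₃] [NormedSpace ℝ E₃]
    [TopologicalSpace M₁] [ChartedSpace E₁ M₁] [TopologicalSpace M₂] [ChartedSpace E₂ M₂]
    [TopologicalSpace M₃] [ChartedSpace E₃ M₃] {g : M₂ → M₃} {f : M₁ → M₂} {x : M₁} {y : M₂}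
    (hg : MDifferentiableAt 𝓘(ℝ, E₂) 𝓘(ℝ, E₃) g y) (hf : MDifferentiableAt 𝓘(ℝ, E₁) 𝓘(ℝ, E₂) f x)
    (hy : f x = y) (v : E₁) :
    (mfderiv 𝓘(ℝ, E₁) 𝓘(ℝ, E₃) (g ∘ f) x v : E₃) =
      (mfderiv 𝓘(ℝ, E₂) 𝓘(ℝ, E₃) g y : E₂ →L[ℝ] E₃)
        ((mfderiv 𝓘(ℝ, E₁) 𝓘(ℝ, E₂) f x : E₁ →L[ℝ] E₂) v) := by
  subst hy
  rw [mfderiv_comp x hg hf]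
  rfl

theorem lieAd_one : lieAd (1 : G) = (1 : Module.End ℝ (GroupLieAlgebra (𝓡 n) G)) := by
  ext1 ξ
  have : (fun x : G => 1 * x * 1⁻¹) = id := by ext; simp
  rw [lieAd_apply, conjDeriv, this, mfderiv_id]
  rfl

variable [LieGroup (𝓡 n) ∞ G]

theorem contMDiff_conj (k : G) : ContMDiff (𝓡 n) (𝓡 n) ∞ (fun x : G => k * x * k⁻¹) :=
  (contMDiff_const.mul contMDiff_id).mul contMDiff_const

theorem mdifferentiableAt_conj (k x : G) :
    MDifferentiableAt (𝓡 n) (𝓡 n) (fun x : G => k * x * k⁻¹) x :=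
  (contMDiff_conj k).mdifferentiable (by simp) x

theorem mdifferentiableAt_mul_left (k x : G) :
    MDifferentiableAt (𝓡 n) (𝓡 n) (fun x : G => k * x) x :=
  (contMDiff_mul_left (I := 𝓡 n) (n := ∞)).mdifferentiable (by simp) x

theorem mdifferentiableAt_mul_right (k x : G) :
    MDifferentiableAt (𝓡 n) (𝓡 n) (fun x : G => x * k) x :=
  (contMDiff_mul_right (I := 𝓡 n) (n := ∞)).mdifferentiable (by simp) x

theorem lieAd_mul (k l : G) :
    (lieAd (k * l) : Module.End ℝ (GroupLieAlgebra (𝓡 n) G)) = lieAd k * lieAd l := by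
  ext1 ξ
  have : (fun x : G => k * l * x * (k * l)⁻¹) =
      (fun x : G => k * x * k⁻¹) ∘ (fun x : G => l * x * l⁻¹) := by ext; simp [mul_assoc]
  rw [lieAd_apply, conjDeriv, this]
  exact mfderiv_comp_apply_of_base_eq (mdifferentiableAt_conj k 1) (mdifferentiableAt_conj l 1)
    (by simp) ξ

/-- The adjoint representation is smooth. -/
theorem contMDiff_conjDeriv : ContMDiff (𝓡 n)
    𝓘(ℝ, EuclideanSpace ℝ (Fin n) →L[ℝ] EuclideanSpace ℝ (Fin n)) ∞
    (conjDeriv n : G → EuclideanSpace ℝ (Fin n) →L[ℝ] EuclideanSpace ℝ (Fin n)) := by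
  intro k
  have hf : ContMDiff ((𝓡 n).prod (𝓡 n)) (𝓡 n) ∞
      (Function.uncurry fun k x : G => k * x * k⁻¹) :=
    (contMDiff_fst.mul contMDiff_snd).mul contMDiff_fst.inv
  have h := ContMDiffAt.mfderiv (m := ∞) (x₀ := k) (fun k x : G => k * x * k⁻¹) (fun _ => 1)
    hf.contMDiffAt contMDiffAt_const (by simp)
  refine h.congr_of_eventuallyEq (Filter.Eventually.of_forall fun l => ?_)
  -- Both ends of the differential sit at `1`, so the coordinate changes hidden in
  -- `inTangentCoordinates` are trivial. At the target this holds only up to the equality `k * 1 *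
  -- k⁻¹ = 1`, so `h2` is stated for general points before substituting.
  have hm (k : G) : k * 1 * k⁻¹ = 1 := by simp
  refine Eq.trans ?_ (inTangentCoordinates_eq (I := 𝓡 n) (I' := 𝓡 n) (fun _ : G => (1 : G))
    (fun x : G => x * 1 * x⁻¹) (conjDeriv n) (by simp) (by simp)).symm
  ext1 v
  have h1 : ∀ v, (tangentBundleCore (𝓡 n) G).coordChange
      (achart (EuclideanSpace ℝ (Fin n)) (1 : G)) (achart _ (1 : G)) 1 v = v :=
    fun v => (tangentBundleCore (𝓡 n) G).coordChange_self (achart _ (1 : G)) 1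
      (mem_chart_source _ _) v
  have h2 : ∀ x y : G, x = 1 → y = 1 → ∀ v, (tangentBundleCore (𝓡 n) G).coordChange
      (achart (EuclideanSpace ℝ (Fin n)) x) (achart _ y) x v = v := by
    rintro x y rfl rfl v
    exact h1 v
  refine Eq.trans ?_ (h2 _ _ (hm l) (hm k) _).symm
  exact congrArg (conjDeriv n l) (h1 v).symm

end AdjointRepresentation

/-! ### The derivative of `Ad` at the identity is the Lie bracket. -/

section AdjointDerivative

open VectorField Topology

variable {n : ℕ} {G : Type*} [TopologicalSpace G] [ChartedSpace (EuclideanSpace ℝ (Fin n)) G]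
  [Group G]

/-- The multiplication of the group, read in the chart at the identity. -/
def chartMul (n : ℕ) (G : Type*) [TopologicalSpace G] [ChartedSpace (EuclideanSpace ℝ (Fin n)) G]
    [Group G] (p : EuclideanSpace ℝ (Fin n) × EuclideanSpace ℝ (Fin n)) :
    EuclideanSpace ℝ (Fin n) :=
  extChartAt (𝓡 n) (1 : G)
    ((extChartAt (𝓡 n) (1 : G)).symm p.1 * (extChartAt (𝓡 n) (1 : G)).symm p.2)

variable (n G) in
/-- The identity, read in the chart at the identity. -/
def chartOne : EuclideanSpace ℝ (Fin n) := extChartAt (𝓡 n) (1 : G) 1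

theorem extChartAt_symm_chartOne : (extChartAt (𝓡 n) (1 : G)).symm (chartOne n G) = 1 :=
  (extChartAt (𝓡 n) (1 : G)).left_inv (mem_extChartAt_source 1)

theorem eventually_chartMul_left :
    ∀ᶠ x in 𝓝 (chartOne n G), chartMul n G (x, chartOne n G) = x := by
  filter_upwards [extChartAt_target_mem_nhds (I := 𝓡 n) (1 : G)] with x hx
  rw [chartMul, extChartAt_symm_chartOne, mul_one, (extChartAt (𝓡 n) (1 : G)).right_inv hx]

theorem conjDeriv_one : conjDeriv n (1 : G) = ContinuousLinearMap.id ℝ _ := by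
  ext1 ξ
  exact congrArg (fun A : Module.End ℝ (GroupLieAlgebra (𝓡 n) G) => A ξ) lieAd_one

variable [LieGroup (𝓡 n) ∞ G]

theorem contMDiffAt_extChartAt_symm_chartOne :
    ContMDiffAt 𝓘(ℝ, EuclideanSpace ℝ (Fin n)) (𝓡 n) ∞ (extChartAt (𝓡 n) (1 : G)).symm
      (chartOne n G) := by
  have : IsManifold (𝓡 n) ∞ G := inferInstance
  exact (contMDiffOn_extChartAt_symm (1 : G)).contMDiffAt (extChartAt_target_mem_nhds (1 : G))

theorem contDiffAt_chartMul : ContDiffAt ℝ ∞ (chartMul n G) (chartOne n G, chartOne n G) := by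
  have : IsManifold (𝓡 n) ∞ G := inferInstance
  rw [← contMDiffAt_iff_contDiffAt]
  have h1 := contMDiffAt_extChartAt_symm_chartOne (n := n) (G := G)
  have hfst : ContMDiffAt 𝓘(ℝ, EuclideanSpace ℝ (Fin n) × EuclideanSpace ℝ (Fin n))
      𝓘(ℝ, EuclideanSpace ℝ (Fin n)) ∞ Prod.fst (chartOne n G, chartOne n G) :=
    contDiff_fst.contMDiff.contMDiffAt
  have hsnd : ContMDiffAt 𝓘(ℝ, EuclideanSpace ℝ (Fin n) × EuclideanSpace ℝ (Fin n))
      𝓘(ℝ, EuclideanSpace ℝ (Fin n)) ∞ Prod.snd (chartOne n G, chartOne n G) :=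
    contDiff_snd.contMDiff.contMDiffAt
  have hm := (h1.comp (chartOne n G, chartOne n G) hfst).mul
    (h1.comp (chartOne n G, chartOne n G) hsnd)
  refine ContMDiffAt.comp_of_eq (y := (1 : G)) (contMDiffAt_extChartAt) hm ?_
  rw [extChartAt_symm_chartOne, mul_one]

theorem eventually_differentiableAt_chartMul :
    ∀ᶠ p in 𝓝 (chartOne n G, chartOne n G), DifferentiableAt ℝ (chartMul n G) p := by
  have h : ContDiffAt ℝ 1 (chartMul n G) (chartOne n G, chartOne n G) :=
    contDiffAt_chartMul.of_le (by simp)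
  filter_upwards [h.eventually (by simp)] with p hp
  exact hp.differentiableAt (by simp)

/-- The left-invariant vector fields, read in the chart at the identity. -/
theorem eventually_mfderiv_extChartAt_mulInvariantVectorField
    (ξ : EuclideanSpace ℝ (Fin n)) :
    ∀ᶠ x in 𝓝 (chartOne n G),
      (mfderiv (𝓡 n) 𝓘(ℝ, EuclideanSpace ℝ (Fin n)) (extChartAt (𝓡 n) (1 : G))
        ((extChartAt (𝓡 n) (1 : G)).symm x)
        (mulInvariantVectorField (I := 𝓡 n) (G := G) ξ ((extChartAt (𝓡 n) (1 : G)).symm x)) :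
          EuclideanSpace ℝ (Fin n)) =
      fderiv ℝ (chartMul n G) (x, chartOne n G) (0, ξ) := by
  have : IsManifold (𝓡 n) 1 G := IsManifold.of_le (n := ∞) (by simp)
  have hl : ContinuousAt (fun x : EuclideanSpace ℝ (Fin n) => (x, chartOne n G)) (chartOne n G) :=
    by fun_prop
  filter_upwards [extChartAt_target_mem_nhds (I := 𝓡 n) (1 : G),
    hl.eventually eventually_differentiableAt_chartMul] with x hx hd
  set k : G := (extChartAt (𝓡 n) (1 : G)).symm x with hk
  have hks : k ∈ (chartAt (EuclideanSpace ℝ (Fin n)) (1 : G)).source := by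
    have := (extChartAt (𝓡 n) (1 : G)).map_target hx
    rwa [extChartAt_source] at this
  have hφ : MDifferentiableAt (𝓡 n) 𝓘(ℝ, EuclideanSpace ℝ (Fin n)) (extChartAt (𝓡 n) (1 : G)) k :=
    mdifferentiableAt_extChartAt hks
  have hL : MDifferentiableAt (𝓡 n) (𝓡 n) (fun y : G => k * y) 1 :=
    mdifferentiableAt_mul_left k 1
  have hc : MDifferentiableAt (𝓡 n) 𝓘(ℝ, EuclideanSpace ℝ (Fin n))
      (extChartAt (𝓡 n) (1 : G) ∘ fun y : G => k * y) 1 :=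
    MDifferentiableAt.comp_of_eq 1 hφ hL (mul_one k)
  have h1 := mfderiv_comp_apply_of_base_eq hφ hL (mul_one k) ξ
  refine h1.symm.trans ?_
  rw [mfderiv_one_eq_fderiv hc]
  have h2 : HasFDerivAt (fun y : EuclideanSpace ℝ (Fin n) => (x, y))
      (ContinuousLinearMap.inr ℝ (EuclideanSpace ℝ (Fin n)) (EuclideanSpace ℝ (Fin n)))
      (chartOne n G) := hasFDerivAt_prodMk_right _ _
  have h3 := (HasFDerivAt.comp (chartOne n G) hd.hasFDerivAt h2).fderiv
  exact congrArg (fun A : EuclideanSpace ℝ (Fin n) →L[ℝ] EuclideanSpace ℝ (Fin n) => A ξ) h3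

/-- The relation `k y = (k y k⁻¹) k`, differentiated at `y = 1` in the chart at the identity. -/
theorem eventually_fderiv_chartMul_conjDeriv (ξ : EuclideanSpace ℝ (Fin n)) :
    ∀ᶠ x in 𝓝 (chartOne n G),
      fderiv ℝ (chartMul n G) (chartOne n G, x)
        (conjDeriv n ((extChartAt (𝓡 n) (1 : G)).symm x) ξ, 0) =
      fderiv ℝ (chartMul n G) (x, chartOne n G) (0, ξ) := by
  have : IsManifold (𝓡 n) 1 G := IsManifold.of_le (n := ∞) (by simp)
  have hl : ContinuousAt (fun x : EuclideanSpace ℝ (Fin n) => (x, chartOne n G)) (chartOne n G) :=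
    by fun_prop
  have hr : ContinuousAt (fun x : EuclideanSpace ℝ (Fin n) => (chartOne n G, x)) (chartOne n G) :=
    by fun_prop
  filter_upwards [extChartAt_target_mem_nhds (I := 𝓡 n) (1 : G),
    hl.eventually eventually_differentiableAt_chartMul,
    hr.eventually eventually_differentiableAt_chartMul] with x hx hd hd'
  set k : G := (extChartAt (𝓡 n) (1 : G)).symm x with hk
  have hks : k ∈ (chartAt (EuclideanSpace ℝ (Fin n)) (1 : G)).source := by
    have := (extChartAt (𝓡 n) (1 : G)).map_target hx
    rwa [extChartAt_source] at this
  have hφ : MDifferentiableAt (𝓡 n) 𝓘(ℝ, EuclideanSpace ℝ (Fin n)) (extChartAt (𝓡 n) (1 : G)) k :=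
    mdifferentiableAt_extChartAt hks
  have hL : MDifferentiableAt (𝓡 n) (𝓡 n) (fun y : G => k * y) 1 :=
    mdifferentiableAt_mul_left k 1
  have hR : MDifferentiableAt (𝓡 n) (𝓡 n) (fun y : G => y * k) 1 :=
    mdifferentiableAt_mul_right k 1
  have hcL : MDifferentiableAt (𝓡 n) 𝓘(ℝ, EuclideanSpace ℝ (Fin n))
      (extChartAt (𝓡 n) (1 : G) ∘ fun y : G => k * y) 1 :=
    MDifferentiableAt.comp_of_eq 1 hφ hL (mul_one k)
  have hcR : MDifferentiableAt (𝓡 n) 𝓘(ℝ, EuclideanSpace ℝ (Fin n))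
      (extChartAt (𝓡 n) (1 : G) ∘ fun y : G => y * k) 1 :=
    MDifferentiableAt.comp_of_eq 1 hφ hR (one_mul k)
  have h1 := mfderiv_comp_apply_of_base_eq hcR (mdifferentiableAt_conj k 1) (by simp) ξ
  have he : (extChartAt (𝓡 n) (1 : G) ∘ fun y : G => y * k) ∘ (fun y : G => k * y * k⁻¹) =
      extChartAt (𝓡 n) (1 : G) ∘ fun y : G => k * y := by ext y : 1; simp
  rw [he, mfderiv_one_eq_fderiv hcR] at h1
  have hr2 : HasFDerivAt (fun y : EuclideanSpace ℝ (Fin n) => (x, y))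
      (ContinuousLinearMap.inr ℝ (EuclideanSpace ℝ (Fin n)) (EuclideanSpace ℝ (Fin n)))
      (chartOne n G) := hasFDerivAt_prodMk_right _ _
  have hl2 : HasFDerivAt (fun y : EuclideanSpace ℝ (Fin n) => (y, x))
      (ContinuousLinearMap.inl ℝ (EuclideanSpace ℝ (Fin n)) (EuclideanSpace ℝ (Fin n)))
      (chartOne n G) := hasFDerivAt_prodMk_left _ _
  have h3 := (HasFDerivAt.comp (chartOne n G) hd.hasFDerivAt hr2).fderiv
  have h4 := (HasFDerivAt.comp (chartOne n G) hd'.hasFDerivAt hl2).fderiv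
  rw [mfderiv_one_eq_fderiv hcL] at h1
  have h5 := congrArg (fun A : EuclideanSpace ℝ (Fin n) →L[ℝ] EuclideanSpace ℝ (Fin n) => A ξ) h3
  have h6 := congrArg (fun A : EuclideanSpace ℝ (Fin n) →L[ℝ] EuclideanSpace ℝ (Fin n) =>
    A (conjDeriv n k ξ)) h4
  exact (h6.symm.trans h1.symm).trans h5

theorem fderiv_chartMul_inl (v : EuclideanSpace ℝ (Fin n)) :
    fderiv ℝ (chartMul n G) (chartOne n G, chartOne n G) (v, 0) = v := by
  have hd : DifferentiableAt ℝ (chartMul n G) (chartOne n G, chartOne n G) :=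
    contDiffAt_chartMul.differentiableAt (by simp)
  have hl : HasFDerivAt (fun y : EuclideanSpace ℝ (Fin n) => (y, chartOne n G))
      (ContinuousLinearMap.inl ℝ (EuclideanSpace ℝ (Fin n)) (EuclideanSpace ℝ (Fin n)))
      (chartOne n G) := hasFDerivAt_prodMk_left _ _
  have h1 := HasFDerivAt.comp (f := fun y : EuclideanSpace ℝ (Fin n) => (y, chartOne n G))
    (chartOne n G) hd.hasFDerivAt hl
  have h2 : HasFDerivAt (fun x => chartMul n G (x, chartOne n G))
      (ContinuousLinearMap.id ℝ (EuclideanSpace ℝ (Fin n))) (chartOne n G) :=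
    (hasFDerivAt_id _).congr_of_eventuallyEq eventually_chartMul_left
  exact congrArg (fun A : EuclideanSpace ℝ (Fin n) →L[ℝ] EuclideanSpace ℝ (Fin n) => A v)
    (h1.unique h2)

/-- The chart expression of a left-invariant vector field is the partial derivative of the
multiplication. -/
theorem eventually_mpullbackWithin_mulInvariantVectorField (ξ : EuclideanSpace ℝ (Fin n)) :
    mpullbackWithin 𝓘(ℝ, EuclideanSpace ℝ (Fin n)) (𝓡 n) (extChartAt (𝓡 n) (1 : G)).symm
        (mulInvariantVectorField (I := 𝓡 n) (G := G) ξ) (Set.range (𝓡 n)) =ᶠ[𝓝 (chartOne n G)]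
      fun x => fderiv ℝ (chartMul n G) (x, chartOne n G) (0, ξ) := by
  have : IsManifold (𝓡 n) 1 G := IsManifold.of_le (n := ∞) (by simp)
  filter_upwards [extChartAt_target_mem_nhds (I := 𝓡 n) (1 : G),
    eventually_mfderiv_extChartAt_mulInvariantVectorField (G := G) ξ] with x hx h
  rw [mpullbackWithin_apply, ContinuousLinearMap.inverse_eq
    (mfderivWithin_extChartAt_symm_comp_mfderiv_extChartAt hx)
    (mfderiv_extChartAt_comp_mfderivWithin_extChartAt_symm hx)]
  exact h

theorem hasFDerivAt_fderiv_chartMul_left (ξ : EuclideanSpace ℝ (Fin n)) :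
    HasFDerivAt (fun x => fderiv ℝ (chartMul n G) (x, chartOne n G) (0, ξ))
      (((ContinuousLinearMap.apply ℝ (EuclideanSpace ℝ (Fin n))
          ((0, ξ) : EuclideanSpace ℝ (Fin n) × EuclideanSpace ℝ (Fin n))).comp
        (fderiv ℝ (fderiv ℝ (chartMul n G)) (chartOne n G, chartOne n G))).comp
        (ContinuousLinearMap.inl ℝ (EuclideanSpace ℝ (Fin n)) (EuclideanSpace ℝ (Fin n))))
      (chartOne n G) := by
  have hd : DifferentiableAt ℝ (fderiv ℝ (chartMul n G)) (chartOne n G, chartOne n G) :=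
    (contDiffAt_chartMul.fderiv_right (m := 1) (by norm_cast)).differentiableAt (by simp)
  have hl : HasFDerivAt (fun y : EuclideanSpace ℝ (Fin n) => (y, chartOne n G))
      (ContinuousLinearMap.inl ℝ (EuclideanSpace ℝ (Fin n)) (EuclideanSpace ℝ (Fin n)))
      (chartOne n G) := hasFDerivAt_prodMk_left _ _
  exact HasFDerivAt.comp (f := fun y : EuclideanSpace ℝ (Fin n) => (y, chartOne n G))
    (chartOne n G) ((ContinuousLinearMap.apply ℝ (EuclideanSpace ℝ (Fin n))
    ((0, ξ) : EuclideanSpace ℝ (Fin n) × EuclideanSpace ℝ (Fin n))).hasFDerivAt.comp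
      (chartOne n G, chartOne n G) hd.hasFDerivAt) hl

/-- The bracket of vector fields is `DW(V) - DV(W)`, and at the identity the two fields take the
values `η` and `ξ`. -/
theorem lieBracket_fderiv_chartMul (η ξ : EuclideanSpace ℝ (Fin n)) :
    lieBracket ℝ (fun x => fderiv ℝ (chartMul n G) (x, chartOne n G) (0, η))
      (fun x => fderiv ℝ (chartMul n G) (x, chartOne n G) (0, ξ)) (chartOne n G) =
    fderiv ℝ (fderiv ℝ (chartMul n G)) (chartOne n G, chartOne n G) (η, 0) (0, ξ) -
      fderiv ℝ (fderiv ℝ (chartMul n G)) (chartOne n G, chartOne n G) (ξ, 0) (0, η) := by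
  -- At the identity the relation `k y = (k y k⁻¹) k` identifies the second partial derivative of
  -- the product with the first, which is the identity map.
  have hinr (v : EuclideanSpace ℝ (Fin n)) :
      fderiv ℝ (chartMul n G) (chartOne n G, chartOne n G) (0, v) = v := by
    have := (eventually_fderiv_chartMul_conjDeriv (G := G) v).self_of_nhds
    rw [extChartAt_symm_chartOne, conjDeriv_one] at this
    exact this.symm.trans (fderiv_chartMul_inl v)
  change fderiv ℝ _ (chartOne n G)
      (fderiv ℝ (chartMul n G) (chartOne n G, chartOne n G) (0, η)) -
    fderiv ℝ _ (chartOne n G)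
      (fderiv ℝ (chartMul n G) (chartOne n G, chartOne n G) (0, ξ)) = _
  rw [hinr, hinr, (hasFDerivAt_fderiv_chartMul_left ξ).fderiv,
    (hasFDerivAt_fderiv_chartMul_left η).fderiv]
  rfl

/-- The Lie bracket in terms of the second derivative of the multiplication in the chart. -/
theorem bracket_eq_sndFDeriv_chartMul (η ξ : GroupLieAlgebra (𝓡 n) G) :
    (⁅η, ξ⁆ : GroupLieAlgebra (𝓡 n) G) =
    fderiv ℝ (fderiv ℝ (chartMul n G)) (chartOne n G, chartOne n G) (η, 0) (0, ξ) -
      fderiv ℝ (fderiv ℝ (chartMul n G)) (chartOne n G, chartOne n G) (ξ, 0) (0, η) := by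
  have : IsManifold (𝓡 n) 1 G := IsManifold.of_le (n := ∞) (by simp)
  have hinv : ∀ (A : EuclideanSpace ℝ (Fin n) →L[ℝ] EuclideanSpace ℝ (Fin n))
      (w : EuclideanSpace ℝ (Fin n)), A = ContinuousLinearMap.id ℝ _ → A.inverse w = w := by
    rintro A w rfl
    rw [ContinuousLinearMap.inverse_id]
    rfl
  refine (hinv _ _ (mfderiv_extChartAt_self (I := 𝓡 n) (x := (1 : G)))).trans ?_
  have hbr : ∀ (V W : EuclideanSpace ℝ (Fin n) → EuclideanSpace ℝ (Fin n))
      (s : Set (EuclideanSpace ℝ (Fin n))) (x : EuclideanSpace ℝ (Fin n)), s = Set.univ →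
      lieBracketWithin ℝ V W s x = lieBracket ℝ V W x := by
    rintro V W s x rfl
    rw [lieBracketWithin_univ]
  refine (hbr _ _ _ _ (by simp)).trans ?_
  have hη := eventually_mpullbackWithin_mulInvariantVectorField (G := G) η
  have hξ := eventually_mpullbackWithin_mulInvariantVectorField (G := G) ξ
  refine (hη.lieBracket_vectorField_eq hξ).trans ?_
  exact lieBracket_fderiv_chartMul η ξ

/-- The derivative of the adjoint representation at the identity. -/
def conjDerivDeriv (n : ℕ) (G : Type*) [TopologicalSpace G]
    [ChartedSpace (EuclideanSpace ℝ (Fin n)) G] [Group G] :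
    EuclideanSpace ℝ (Fin n) →L[ℝ] EuclideanSpace ℝ (Fin n) →L[ℝ] EuclideanSpace ℝ (Fin n) :=
  mfderiv (𝓡 n) 𝓘(ℝ, EuclideanSpace ℝ (Fin n) →L[ℝ] EuclideanSpace ℝ (Fin n))
    (conjDeriv n : G → _) 1

/-- Let `μ` be the product in the chart and `c` the identity. Differentiating `∂₁μ(c,x)(Ad_x ξ) =
∂₂μ(x,c) ξ` at `x = c` along `η` gives `Ad'(η) ξ + D²μ(0,η)(ξ,0) = D²μ(η,0)(0,ξ)`; symmetry of `D²μ`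
then yields the expression already found for the bracket. -/
theorem conjDerivDeriv_eq_sndFDeriv_chartMul (η ξ : EuclideanSpace ℝ (Fin n)) :
    conjDerivDeriv n G η ξ =
      fderiv ℝ (fderiv ℝ (chartMul n G)) (chartOne n G, chartOne n G) (η, 0) (0, ξ) -
        fderiv ℝ (fderiv ℝ (chartMul n G)) (chartOne n G, chartOne n G) (ξ, 0) (0, η) := by
  set c := chartOne n G with hc
  set D2 := fderiv ℝ (fderiv ℝ (chartMul n G)) (c, c) with hD2
  have hd : DifferentiableAt ℝ (fderiv ℝ (chartMul n G)) (c, c) :=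
    (contDiffAt_chartMul.fderiv_right (m := 1) (by norm_cast)).differentiableAt (by simp)
  have hA : MDifferentiableAt (𝓡 n)
      𝓘(ℝ, EuclideanSpace ℝ (Fin n) →L[ℝ] EuclideanSpace ℝ (Fin n)) (conjDeriv n : G → _) 1 :=
    contMDiff_conjDeriv.mdifferentiable (by simp) 1
  have hA' : DifferentiableAt ℝ
      ((conjDeriv n : G → _) ∘ (extChartAt (𝓡 n) (1 : G)).symm) c := by
    rw [← mdifferentiableAt_iff_differentiableAt]
    exact MDifferentiableAt.comp_of_eq _ hA
      (contMDiffAt_extChartAt_symm_chartOne.mdifferentiableAt (by simp)) extChartAt_symm_chartOne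
  have hr : HasFDerivAt (fun y : EuclideanSpace ℝ (Fin n) => (c, y))
      (ContinuousLinearMap.inr ℝ (EuclideanSpace ℝ (Fin n)) (EuclideanSpace ℝ (Fin n)))
      c := hasFDerivAt_prodMk_right _ _
  have hDr : HasFDerivAt (fun y => fderiv ℝ (chartMul n G) (c, y)) (D2.comp
      (ContinuousLinearMap.inr ℝ (EuclideanSpace ℝ (Fin n)) (EuclideanSpace ℝ (Fin n)))) c :=
    HasFDerivAt.comp c hd.hasFDerivAt hr
  have hv := ((ContinuousLinearMap.inl ℝ (EuclideanSpace ℝ (Fin n))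
    (EuclideanSpace ℝ (Fin n))).hasFDerivAt.comp c
      ((ContinuousLinearMap.apply ℝ (EuclideanSpace ℝ (Fin n)) ξ).hasFDerivAt.comp c
        hA'.hasFDerivAt))
  have hL := hDr.clm_apply hv
  have hR := (hasFDerivAt_fderiv_chartMul_left (G := G) ξ).congr_of_eventuallyEq
    (eventually_fderiv_chartMul_conjDeriv (G := G) ξ)
  have h := congrArg (fun A : EuclideanSpace ℝ (Fin n) →L[ℝ] EuclideanSpace ℝ (Fin n) => A η)
    (hL.unique hR)
  rw [conjDerivDeriv, mfderiv_one_eq_fderiv hA]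
  have hsymm : IsSymmSndFDerivAt ℝ (chartMul n G) (c, c) :=
    contDiffAt_chartMul.isSymmSndFDerivAt
      (by rw [minSmoothness_of_isRCLikeNormedField]; exact WithTop.coe_le_coe.2 le_top)
  have h' : fderiv ℝ (chartMul n G) (c, c)
        (fderiv ℝ ((conjDeriv n : G → _) ∘ (extChartAt (𝓡 n) (1 : G)).symm) c η ξ, 0) +
      D2 (0, η) (conjDeriv n ((extChartAt (𝓡 n) (1 : G)).symm c) ξ, 0) = D2 (η, 0) (0, ξ) := h
  rw [extChartAt_symm_chartOne, conjDeriv_one, fderiv_chartMul_inl, hsymm.eq] at h'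
  exact eq_sub_of_add_eq h'

/-- The derivative of the adjoint representation at the identity is the Lie bracket. -/
theorem conjDerivDeriv_apply (η ξ : GroupLieAlgebra (𝓡 n) G) :
    conjDerivDeriv n G η ξ = (⁅η, ξ⁆ : GroupLieAlgebra (𝓡 n) G) := by
  exact (conjDerivDeriv_eq_sndFDeriv_chartMul η ξ).trans (bracket_eq_sndFDeriv_chartMul η ξ).symm

end AdjointDerivative

/-! ### Curves through the identity and their velocities. -/

section Curves

open Topology

/-- The derivative of a vector-valued function along a curve. -/
theorem hasDerivAt_comp_curve {n : ℕ} {M : Type*} [TopologicalSpace M]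
    [ChartedSpace (EuclideanSpace ℝ (Fin n)) M] {F : Type*} [NormedAddCommGroup F] [NormedSpace ℝ F]
    {f : M → F} {γ : ℝ → M} {k : M} (hf : MDifferentiableAt (𝓡 n) 𝓘(ℝ, F) f k)
    (hγ : MDifferentiableAt 𝓘(ℝ, ℝ) (𝓡 n) γ 0) (h0 : γ 0 = k) :
    HasDerivAt (f ∘ γ) ((mfderiv (𝓡 n) 𝓘(ℝ, F) f k : EuclideanSpace ℝ (Fin n) →L[ℝ] F)
      (mfderiv 𝓘(ℝ, ℝ) (𝓡 n) γ 0 (1 : ℝ) : EuclideanSpace ℝ (Fin n))) 0 := by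
  have hd : DifferentiableAt ℝ (f ∘ γ) 0 := by
    rw [← mdifferentiableAt_iff_differentiableAt]
    exact MDifferentiableAt.comp_of_eq _ hf hγ h0
  have h := mfderiv_comp_apply_of_base_eq hf hγ h0 (1 : ℝ)
  rw [mfderiv_eq_fderiv] at h
  have h' := hd.hasFDerivAt.hasDerivAt
  exact h ▸ h'

variable {n : ℕ} {G : Type*} [TopologicalSpace G] [ChartedSpace (EuclideanSpace ℝ (Fin n)) G]
  [Group G]

/-- `γ` is a smooth germ of a curve through the identity, with velocity `ξ` at time `0`. -/
structure HasVelocityAtOne (γ : ℝ → G) (ξ : GroupLieAlgebra (𝓡 n) G) : Prop where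
  map_zero : γ 0 = 1
  contMDiffAt : ContMDiffAt 𝓘(ℝ, ℝ) (𝓡 n) ∞ γ 0
  mfderiv_eq : (mfderiv 𝓘(ℝ, ℝ) (𝓡 n) γ 0 (1 : ℝ) : EuclideanSpace ℝ (Fin n)) = ξ

theorem HasVelocityAtOne.mdifferentiableAt {γ : ℝ → G} {ξ : GroupLieAlgebra (𝓡 n) G}
    (h : HasVelocityAtOne γ ξ) : MDifferentiableAt 𝓘(ℝ, ℝ) (𝓡 n) γ 0 :=
  h.contMDiffAt.mdifferentiableAt (by simp)

theorem isVelocityAtOne_iff {K : Subgroup G} {ξ : GroupLieAlgebra (𝓡 n) G} :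
    IsVelocityAtOne K ξ ↔ ∃ γ : ℝ → G, HasVelocityAtOne γ ξ ∧ ∀ᶠ t in 𝓝 (0 : ℝ), γ t ∈ K :=
  ⟨fun ⟨γ, h0, hs, hK, hd⟩ => ⟨γ, ⟨h0, hs, hd⟩, hK⟩,
    fun ⟨γ, ⟨h0, hs, hd⟩, hK⟩ => ⟨γ, h0, hs, hK, hd⟩⟩

theorem HasVelocityAtOne.comp {f : G → G} {γ : ℝ → G} {ξ : GroupLieAlgebra (𝓡 n) G}
    (h : HasVelocityAtOne γ ξ) (hf : ContMDiffAt (𝓡 n) (𝓡 n) ∞ f 1) (h1 : f 1 = 1) :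
    HasVelocityAtOne (f ∘ γ)
      ((mfderiv (𝓡 n) (𝓡 n) f 1 : EuclideanSpace ℝ (Fin n) →L[ℝ] EuclideanSpace ℝ (Fin n)) ξ) where
  map_zero := by simp [h.map_zero, h1]
  contMDiffAt := ContMDiffAt.comp_of_eq hf h.contMDiffAt h.map_zero
  mfderiv_eq := by
    have := mfderiv_comp_apply_of_base_eq (hf.mdifferentiableAt (by simp)) h.mdifferentiableAt
      h.map_zero (1 : ℝ)
    rw [h.mfderiv_eq] at this
    exact this

theorem HasVelocityAtOne.unique {γ δ : ℝ → G} {ξ η : GroupLieAlgebra (𝓡 n) G}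
    (h : HasVelocityAtOne γ ξ) (h' : HasVelocityAtOne δ η) (heq : γ =ᶠ[𝓝 0] δ) : ξ = η := by
  have h1 : (mfderiv 𝓘(ℝ, ℝ) (𝓡 n) γ 0 : ℝ →L[ℝ] EuclideanSpace ℝ (Fin n)) =
      (mfderiv 𝓘(ℝ, ℝ) (𝓡 n) δ 0 : ℝ →L[ℝ] EuclideanSpace ℝ (Fin n)) := heq.mfderiv_eq
  exact h.mfderiv_eq.symm.trans
    ((congrArg (fun A : ℝ →L[ℝ] EuclideanSpace ℝ (Fin n) => A 1) h1).trans h'.mfderiv_eq)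

variable [LieGroup (𝓡 n) ∞ G]

theorem HasVelocityAtOne.conj {γ : ℝ → G} {ξ : GroupLieAlgebra (𝓡 n) G}
    (h : HasVelocityAtOne γ ξ) (k : G) :
    HasVelocityAtOne (fun t => k * γ t * k⁻¹) (lieAd k ξ) :=
  h.comp (contMDiff_conj k 1) (by simp)

theorem HasVelocityAtOne.mul {γ δ : ℝ → G} {ξ η : GroupLieAlgebra (𝓡 n) G}
    (hγ : HasVelocityAtOne γ ξ) (hδ : HasVelocityAtOne δ η) :
    HasVelocityAtOne (fun t => γ t * δ t) (ξ + η) := by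
  obtain ⟨h1, hs, hd⟩ := hγ
  obtain ⟨h1', hs', hd'⟩ := hδ
  refine ⟨by simp [h1, h1'], hs.mul hs', ?_⟩
  have hm : MDifferentiableAt ((𝓡 n).prod (𝓡 n)) (𝓡 n) (fun p : G × G => p.1 * p.2)
      (γ 0, δ 0) := (contMDiff_mul (𝓡 n) ∞).mdifferentiable (by simp) _
  have hg := hs.mdifferentiableAt (by simp)
  have hg' := hs'.mdifferentiableAt (by simp)
  have hc : (fun t => γ t * δ t) = (fun p : G × G => p.1 * p.2) ∘ fun t => (γ t, δ t) := rfl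
  rw [hc, mfderiv_comp_of_eq hm (hg.prodMk hg') rfl, mfderiv_prodMk hg hg']
  subst hd hd'
  refine (mfderiv_prod_eq_add_apply hm).trans ?_
  have key : ∀ (φ : G → G) (x : G) (v : EuclideanSpace ℝ (Fin n)), φ = id →
      (mfderiv (𝓡 n) (𝓡 n) φ x v : EuclideanSpace ℝ (Fin n)) = v := by
    rintro φ x v rfl
    rw [mfderiv_id]
    rfl
  exact congrArg₂ (fun x y : EuclideanSpace ℝ (Fin n) => x + y)
    (key (fun z : G => z * δ 0) (γ 0) _ (by ext; simp [h1']))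
    (key (fun z : G => γ 0 * z) (δ 0) _ (by ext; simp [h1]))

/-- Every element of the Lie algebra is the velocity of a curve. -/
theorem exists_hasVelocityAtOne (ξ : GroupLieAlgebra (𝓡 n) G) :
    ∃ γ : ℝ → G, HasVelocityAtOne γ ξ := by
  have : IsManifold (𝓡 n) 1 G := IsManifold.of_le (n := ∞) (by simp)
  have hl : ∀ v : EuclideanSpace ℝ (Fin n),
      HasDerivAt (fun t : ℝ => chartOne n G + t • v) v 0 := fun v => by
    simpa using ((hasDerivAt_id (0 : ℝ)).smul_const v).const_add (chartOne n G)
  have hl' : ∀ v : EuclideanSpace ℝ (Fin n),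
      ContDiff ℝ ∞ (fun t : ℝ => chartOne n G + t • v) := fun v => by fun_prop
  have h0 : ∀ v : EuclideanSpace ℝ (Fin n), chartOne n G + (0 : ℝ) • v = chartOne n G := by simp
  suffices h : ∀ ξ : EuclideanSpace ℝ (Fin n), ∃ γ : ℝ → G, HasVelocityAtOne (n := n) γ ξ from h ξ
  intro ξ
  refine ⟨(extChartAt (𝓡 n) (1 : G)).symm ∘ fun t : ℝ => chartOne n G + t • ξ, ?_, ?_, ?_⟩
  · exact (congrArg _ (h0 ξ)).trans extChartAt_symm_chartOne
  · exact ContMDiffAt.comp_of_eq contMDiffAt_extChartAt_symm_chartOne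
      (hl' ξ).contMDiff.contMDiffAt (h0 ξ)
  · have h := mfderiv_comp_apply_of_base_eq
      ((contMDiffAt_extChartAt_symm_chartOne (n := n) (G := G)).mdifferentiableAt (by simp))
      ((hl' ξ).contMDiff.contMDiffAt.mdifferentiableAt (by simp)) (h0 ξ) (1 : ℝ)
    have h1 : (mfderiv 𝓘(ℝ, ℝ) 𝓘(ℝ, EuclideanSpace ℝ (Fin n))
        (fun t : ℝ => chartOne n G + t • ξ) 0 :
          ℝ →L[ℝ] EuclideanSpace ℝ (Fin n)) 1 = ξ := by
      rw [mfderiv_eq_fderiv]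
      exact (hl ξ).deriv
    have h2 : (mfderiv 𝓘(ℝ, EuclideanSpace ℝ (Fin n)) (𝓡 n) (extChartAt (𝓡 n) (1 : G)).symm
        (chartOne n G) : EuclideanSpace ℝ (Fin n) →L[ℝ] EuclideanSpace ℝ (Fin n)) =
          ContinuousLinearMap.id ℝ _ := by
      have := mfderivWithin_range_extChartAt_symm (I := 𝓡 n) (x := (1 : G))
      rw [ModelWithCorners.range_eq_univ, mfderivWithin_univ] at this
      exact this
    exact h.trans ((congrArg _ h1).trans
      (congrArg (fun A : EuclideanSpace ℝ (Fin n) →L[ℝ] EuclideanSpace ℝ (Fin n) => A ξ) h2))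

theorem HasVelocityAtOne.hasDerivAt_conjDeriv {γ : ℝ → G} {ξ : GroupLieAlgebra (𝓡 n) G}
    (h : HasVelocityAtOne γ ξ) :
    HasDerivAt (fun t => conjDeriv n (γ t)) (conjDerivDeriv n G ξ) 0 := by
  have := hasDerivAt_comp_curve (contMDiff_conjDeriv.mdifferentiable (by simp) 1)
    h.mdifferentiableAt h.map_zero
  rw [h.mfderiv_eq] at this
  exact this

/-- The derivative of the adjoint representation along a curve. -/
theorem HasVelocityAtOne.hasDerivAt_lieAd {γ : ℝ → G} {η : GroupLieAlgebra (𝓡 n) G}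
    (h : HasVelocityAtOne γ η) (k : G) (ξ : GroupLieAlgebra (𝓡 n) G) :
    HasDerivAt (F := EuclideanSpace ℝ (Fin n)) (fun t => lieAd (k * γ t) ξ)
      (lieAd k ⁅η, ξ⁆) 0 := by
  have hv (v : EuclideanSpace ℝ (Fin n)) :
      HasDerivAt (fun t => conjDeriv n (γ t) v) (conjDerivDeriv n G η v) 0 :=
    (ContinuousLinearMap.apply ℝ (EuclideanSpace ℝ (Fin n)) v).hasFDerivAt.comp_hasDerivAt 0
      h.hasDerivAt_conjDeriv
  have h1 : HasDerivAt (fun t => conjDeriv n (γ t) ξ) (conjDerivDeriv n G η ξ) 0 :=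
    hv ξ
  have h2 : HasDerivAt (fun t => conjDeriv n k (conjDeriv n (γ t) ξ))
      (conjDeriv n k (conjDerivDeriv n G η ξ)) 0 :=
    (conjDeriv n k).hasFDerivAt.comp_hasDerivAt 0 h1
  rw [conjDerivDeriv_apply] at h2
  refine h2.congr_of_eventuallyEq (Filter.Eventually.of_forall fun t => ?_)
  exact congrArg (fun A : Module.End ℝ (GroupLieAlgebra (𝓡 n) G) => A ξ) (lieAd_mul k (γ t))

end Curves

/-! ### Invariance of the bracket, the inner product and the splitting `𝔤 = 𝔥 ⊕ 𝔥^⊥`. -/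

section Invariance

open Topology

variable {n : ℕ} {G : Type*} [TopologicalSpace G] [ChartedSpace (EuclideanSpace ℝ (Fin n)) G]
  [Group G] [LieGroup (𝓡 n) ∞ G]

theorem lieAd_inv_lieAd (k : G) (ξ : GroupLieAlgebra (𝓡 n) G) : lieAd k⁻¹ (lieAd k ξ) = ξ := by
  rw [← Module.End.mul_apply, ← lieAd_mul, inv_mul_cancel, lieAd_one, Module.End.one_apply]

theorem lieAd_lieAd_inv (k : G) (ξ : GroupLieAlgebra (𝓡 n) G) : lieAd k (lieAd k⁻¹ ξ) = ξ := by
  rw [← Module.End.mul_apply, ← lieAd_mul, mul_inv_cancel, lieAd_one, Module.End.one_apply]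

variable (n G) in
theorem lieGroup_minSmoothness : LieGroup (𝓡 n) (minSmoothness ℝ 3) G :=
  LieGroup.of_le (n := ∞) (by
    rw [minSmoothness_of_isRCLikeNormedField]; exact WithTop.coe_le_coe.2 le_top)

variable (n G) in
/-- The Lie bracket as a bilinear map. -/
def lieBracketₗ : GroupLieAlgebra (𝓡 n) G →ₗ[ℝ] GroupLieAlgebra (𝓡 n) G →ₗ[ℝ]
    GroupLieAlgebra (𝓡 n) G :=
  haveI := lieGroup_minSmoothness n G
  LinearMap.mk₂ ℝ (fun x y => ⁅x, y⁆) add_lie smul_lie lie_add lie_smul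

theorem lieBracketₗ_skew (x y : GroupLieAlgebra (𝓡 n) G) :
    lieBracketₗ n G x y = -lieBracketₗ n G y x :=
  haveI := lieGroup_minSmoothness n G
  (lie_skew x y).symm

/-- The adjoint representation acts by Lie algebra automorphisms. -/
theorem lieAd_bracket (k : G) (η ξ : GroupLieAlgebra (𝓡 n) G) :
    lieAd k ⁅η, ξ⁆ = ⁅lieAd k η, lieAd k ξ⁆ := by
  obtain ⟨γ, hγ⟩ := exists_hasVelocityAtOne η
  have h1 := hγ.hasDerivAt_lieAd k ξ
  have h2 := (hγ.conj k).hasDerivAt_lieAd 1 (lieAd k ξ)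
  -- The two sides of the claim are derivatives of one curve, because `(k γ k⁻¹) k = k γ`.
  have he : (fun t => lieAd (1 * (k * γ t * k⁻¹)) (lieAd k ξ)) = fun t => lieAd (k * γ t) ξ := by
    ext1 t
    rw [← Module.End.mul_apply, ← lieAd_mul]
    congr 2
    group
  rw [he, lieAd_one] at h2
  exact h1.unique h2

/-- Difference quotients stay in `W`, which is closed by finite dimensionality. -/
theorem mem_of_hasDerivAt {F : Type*} [NormedAddCommGroup F] [NormedSpace ℝ F]
    [FiniteDimensional ℝ F] {W : Submodule ℝ F} {f : ℝ → F} {v : F} (hf : HasDerivAt f v 0)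
    (h : ∀ᶠ t in 𝓝 (0 : ℝ), f t ∈ W) : v ∈ W := by
  refine W.closed_of_finiteDimensional.mem_of_tendsto hf.tendsto_slope ?_
  filter_upwards [nhdsWithin_le_nhds h] with t ht
  exact W.smul_mem _ (W.sub_mem ht h.self_of_nhds)

theorem lieAd_mem_subgroupLie {K : Subgroup G} {k : G} (hk : k ∈ K)
    {ξ : GroupLieAlgebra (𝓡 n) G} (hξ : ξ ∈ subgroupLie K) : lieAd k ξ ∈ subgroupLie K := by
  obtain ⟨γ, hγ, hK⟩ := isVelocityAtOne_iff.1 hξ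
  refine isVelocityAtOne_iff.2 ⟨_, hγ.conj k, ?_⟩
  filter_upwards [hK] with t ht
  exact K.mul_mem (K.mul_mem hk ht) (K.inv_mem hk)

/-- The bracket is the derivative of `Ad_{γ(t)} ξ`, a curve that stays in the Lie algebra of `K`
when `γ` stays in `K`. -/
theorem bracket_mem_subgroupLie {K : Subgroup G} {η ξ : GroupLieAlgebra (𝓡 n) G}
    (hη : η ∈ subgroupLie K) (hξ : ξ ∈ subgroupLie K) : ⁅η, ξ⁆ ∈ subgroupLie K := by
  obtain ⟨γ, hγ, hK⟩ := isVelocityAtOne_iff.1 hη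
  have h := hγ.hasDerivAt_lieAd 1 ξ
  rw [lieAd_one] at h
  refine mem_of_hasDerivAt (F := EuclideanSpace ℝ (Fin n)) (W := subgroupLie K) h ?_
  filter_upwards [hK] with t ht
  rw [one_mul]
  exact lieAd_mem_subgroupLie ht hξ

variable (B : InvariantInnerProduct n G)

theorem form_lieAd_left (k : G) (x y : GroupLieAlgebra (𝓡 n) G) :
    B.form (lieAd k x) y = B.form x (lieAd k⁻¹ y) := by
  rw [← B.invariant k x, lieAd_lieAd_inv]

/-- The inner product is infinitesimally invariant. -/
theorem form_bracket (η x y : GroupLieAlgebra (𝓡 n) G) :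
    B.form ⁅η, x⁆ y + B.form x ⁅η, y⁆ = 0 := by
  obtain ⟨γ, hγ⟩ := exists_hasVelocityAtOne η
  have hx := hγ.hasDerivAt_lieAd 1 x
  have hy := hγ.hasDerivAt_lieAd 1 y
  let L : EuclideanSpace ℝ (Fin n) →L[ℝ] EuclideanSpace ℝ (Fin n) →L[ℝ] ℝ :=
    LinearMap.toContinuousBilinearMap B.form
  have h := L.hasDerivAt_of_bilinear (fun _ => hx) (fun _ => hy)
  have hc : (fun t => L (lieAd (1 * γ t) x) (lieAd (1 * γ t) y)) = fun _ => B.form x y := by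
    ext1 t
    exact B.invariant _ x y
  rw [hc, hγ.map_zero, mul_one, lieAd_one] at h
  have := h.unique (hasDerivAt_const 0 _)
  exact (add_comm _ _).trans this

theorem lieAd_mem_perp {K : Subgroup G} {k : G} (hk : k ∈ K) {ξ : GroupLieAlgebra (𝓡 n) G}
    (hξ : ξ ∈ B.perp (subgroupLie K)) : lieAd k ξ ∈ B.perp (subgroupLie K) := by
  intro x hx
  have := hξ _ (lieAd_mem_subgroupLie (K.inv_mem hk) hx)
  rwa [form_lieAd_left, inv_inv] at this

theorem bracket_mem_perp {K : Subgroup G} {η ξ : GroupLieAlgebra (𝓡 n) G}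
    (hη : η ∈ subgroupLie K) (hξ : ξ ∈ B.perp (subgroupLie K)) :
    ⁅η, ξ⁆ ∈ B.perp (subgroupLie K) := by
  intro x hx
  have := hξ _ (bracket_mem_subgroupLie hη hx)
  have h := form_bracket B η x ξ
  rwa [this, zero_add] at h

end Invariance

/-! ### The infinitesimal consequence of the slice property. -/

section Slice

open Topology

variable {n : ℕ} {G : Type*} [TopologicalSpace G] [ChartedSpace (EuclideanSpace ℝ (Fin n)) G]
  [Group G] [LieGroup (𝓡 n) ∞ G]

/-- Near a point of a slice, the Lie algebra is spanned by the tangent directions of the slice and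
of the conjugacy class. -/
theorem exists_add_eq_of_isConjSlice {g : G} {U : Set G} (hU : IsConjSlice (n := n) g U)
    {u : G} (hu : u ∈ U) (ζ : GroupLieAlgebra (𝓡 n) G) :
    ∃ ξ : GroupLieAlgebra (𝓡 n) G, ∃ η ∈ subgroupLie (n := n) (stab g),
      lieAd u⁻¹ ξ - ξ + η = ζ := by
  obtain ⟨W, κ, υ, hW, hwu, hκ, hυ, hκ1, hυ1, hκυ⟩ := hU.smooth_inverse 1 u hu
  simp only [one_mul, inv_one, mul_one] at hwu hκ1 hυ1
  obtain ⟨δ, hδ⟩ := exists_hasVelocityAtOne ζ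
  have hL : ContMDiffAt (𝓡 n) (𝓡 n) ∞ (fun x : G => u * x) 1 := contMDiff_mul_left.contMDiffAt
  have hκ' : ContMDiffAt (𝓡 n) (𝓡 n) ∞ (fun x : G => κ (u * x)) 1 :=
    ContMDiffAt.comp_of_eq (hκ.contMDiffAt (hW.mem_nhds hwu)) hL (mul_one u)
  have hυ' : ContMDiffAt (𝓡 n) (𝓡 n) ∞ (fun x : G => u⁻¹ * υ (u * x)) 1 :=
    contMDiffAt_const.mul
      (ContMDiffAt.comp_of_eq (hυ.contMDiffAt (hW.mem_nhds hwu)) hL (mul_one u))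
  obtain ⟨ξ, hK⟩ : ∃ ξ : GroupLieAlgebra (𝓡 n) G, HasVelocityAtOne (fun t => κ (u * δ t)) ξ :=
    ⟨_, hδ.comp hκ' (by simp [hκ1])⟩
  obtain ⟨η, hH⟩ : ∃ η : GroupLieAlgebra (𝓡 n) G,
      HasVelocityAtOne (fun t => u⁻¹ * υ (u * δ t)) η :=
    ⟨_, hδ.comp hυ' (by simp [hυ1])⟩
  have hmem : ∀ᶠ t in 𝓝 (0 : ℝ), u * δ t ∈ W := by
    have : ContinuousAt (fun t => u * δ t) 0 :=
      ContinuousAt.comp_of_eq (f := δ) hL.continuousAt hδ.contMDiffAt.continuousAt hδ.map_zero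
    refine this.eventually (hW.mem_nhds ?_)
    simpa [hδ.map_zero] using hwu
  have hstab : ∀ᶠ t in 𝓝 (0 : ℝ), u⁻¹ * υ (u * δ t) ∈ stab g := by
    filter_upwards [hmem] with t ht
    exact (stab g).mul_mem ((stab g).inv_mem (hU.subset_stab hu))
      (hU.subset_stab (hκυ _ ht).1)
  refine ⟨ξ, η, isVelocityAtOne_iff.2 ⟨_, hH, hstab⟩, ?_⟩
  -- With `κ`, `υ` evaluated at `u δ`, the relation `κ υ κ⁻¹ = u δ` becomes `(u⁻¹ κ u)(u⁻¹ υ) = δ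
  -- κ`, a product of curves through `1` on each side; velocities give `Ad_{u⁻¹} ξ + η = ζ + ξ`.
  have h := ((hK.conj u⁻¹).mul hH).unique (hδ.mul hK) (by
    filter_upwards [hmem] with t ht
    have := (hκυ _ ht).2
    rw [mul_inv_eq_iff_eq_mul] at this
    calc u⁻¹ * κ (u * δ t) * u⁻¹⁻¹ * (u⁻¹ * υ (u * δ t))
        = u⁻¹ * (κ (u * δ t) * υ (u * δ t)) := by group
      _ = δ t * κ (u * δ t) := by rw [this]; group)
  rw [sub_add_eq_add_sub, h, add_sub_cancel_right]

end Slice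

/-! ### The Cayley transform as a smooth function of the operator. -/

section CayleyTransform

variable {F : Type*} [NormedAddCommGroup F] [NormedSpace ℝ F]

/-- The operator `-½ (A + 1)/(A - 1)` on the kernel of the projection `p`, extended by zero on the
range of `p` (when `A - 1` is invertible on the kernel). -/
def cayleyExt (p A : F →L[ℝ] F) : F →L[ℝ] F :=
  (-(1 / 2 : ℝ)) • ((A + 1) * (1 - p) * Ring.inverse ((A - 1) * (1 - p) + p))

/-- When `p` is a projection, the inverted operator is `A - 1` on the kernel of `p` and the identity
on its range. Inverting on the whole space instead of a subspace makes smoothness of `Ring.inverse`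
at units applicable. -/
theorem cayleyExt_apply {p A : F →L[ℝ] F} (h : IsUnit ((A - 1) * (1 - p) + p)) (y : F) :
    cayleyExt p A (A (y - p y) - (y - p y) + p y) =
      -(1 / 2 : ℝ) • (A (y - p y) + (y - p y)) := by
  have h1 : A (y - p y) - (y - p y) + p y = ((A - 1) * (1 - p) + p) y := by simp
  have h2 : Ring.inverse ((A - 1) * (1 - p) + p) (((A - 1) * (1 - p) + p) y) = y := by
    rw [← mul_apply_eq_comp, Ring.inverse_mul_cancel _ h,
      one_apply_eq_self]
  rw [h1, cayleyExt, smul_apply, mul_apply_eq_comp, h2]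
  simp

theorem contDiffAt_cayleyExt [CompleteSpace F] {p A : F →L[ℝ] F}
    (h : IsUnit ((A - 1) * (1 - p) + p)) : ContDiffAt ℝ ∞ (cayleyExt p) A := by
  obtain ⟨N, hN⟩ := h
  have hin : ContDiffAt ℝ ∞ (fun A : F →L[ℝ] F => (A - 1) * (1 - p) + p) A :=
    ((contDiffAt_id.sub contDiffAt_const).mul contDiffAt_const).add contDiffAt_const
  have hinv : ContDiffAt ℝ ∞ (fun A : F →L[ℝ] F => Ring.inverse ((A - 1) * (1 - p) + p)) A := by
    have := contDiffAt_ringInverse (n := ∞) ℝ N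
    rw [hN] at this
    exact this.comp A hin
  exact (((contDiffAt_id.add contDiffAt_const).mul contDiffAt_const).mul hinv).const_smul _

end CayleyTransform

/-! ### Orthogonal projections, and `r` on the two summands. -/

section Projections

variable {n : ℕ} {G : Type*} [TopologicalSpace G] [ChartedSpace (EuclideanSpace ℝ (Fin n)) G]
  [Group G] (B : InvariantInnerProduct n G) (W : Submodule ℝ (GroupLieAlgebra (𝓡 n) G))

theorem proj_mem (x : GroupLieAlgebra (𝓡 n) G) : B.proj W x ∈ W :=
  Submodule.projection_apply_mem _ x

theorem sub_proj_mem (x : GroupLieAlgebra (𝓡 n) G) : x - B.proj W x ∈ B.perp W :=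
  Submodule.sub_projection_mem _ x

/-- Expansion of `v` in the orthonormal basis; it removes the sums over repeated indices. -/
theorem sum_form_mul_form {ι : Type*} [Fintype ι] [DecidableEq ι]
    (e : Module.Basis ι ℝ (GroupLieAlgebra (𝓡 n) G))
    (he : ∀ a b, B.form (e a) (e b) = if a = b then 1 else 0)
    (f : GroupLieAlgebra (𝓡 n) G →ₗ[ℝ] ℝ) (v : GroupLieAlgebra (𝓡 n) G) :
    ∑ k, f (e k) * B.form (e k) v = f v := by
  have hrepr (k : ι) : B.form (e k) v = e.repr v k := by
    conv_lhs => rw [← e.sum_repr v]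
    simp only [map_sum, map_smul, he, smul_eq_mul, mul_ite, mul_one, mul_zero,
      Finset.sum_ite_eq, Finset.mem_univ, if_true]
  conv_rhs => rw [← e.sum_repr v]
  rw [map_sum]
  refine Finset.sum_congr rfl fun k _ => ?_
  rw [hrepr, map_smul, smul_eq_mul, mul_comm]

variable {W}

theorem proj_of_mem {x : GroupLieAlgebra (𝓡 n) G} (hx : x ∈ W) : B.proj W x = x :=
  Submodule.projection_apply_of_mem_left _ hx

theorem proj_of_mem_perp {x : GroupLieAlgebra (𝓡 n) G} (hx : x ∈ B.perp W) : B.proj W x = 0 :=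
  (Submodule.projection_apply_eq_zero_iff _).2 hx

theorem projPerp_of_mem {x : GroupLieAlgebra (𝓡 n) G} (hx : x ∈ W) : B.projPerp W x = 0 :=
  (Submodule.projectionOnto_apply_eq_zero_iff _).2 hx

theorem projPerp_of_mem_perp {x : GroupLieAlgebra (𝓡 n) G} (hx : x ∈ B.perp W) :
    (B.projPerp W x : GroupLieAlgebra (𝓡 n) G) = x :=
  congrArg Subtype.val (Submodule.projectionOnto_apply_of_mem_left (B.isCompl_perp W).symm hx)

theorem form_eq_zero {x y : GroupLieAlgebra (𝓡 n) G} (hx : x ∈ W) (hy : y ∈ B.perp W) :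
    B.form x y = 0 := hy x hx

theorem eq_zero_of_mem_of_mem_perp {x : GroupLieAlgebra (𝓡 n) G} (hx : x ∈ W)
    (hx' : x ∈ B.perp W) : x = 0 := by
  by_contra h
  exact (B.pos x h).ne' (form_eq_zero B hx hx')

theorem rOperator_of_mem (u : G) {x : GroupLieAlgebra (𝓡 n) G} (hx : x ∈ W) :
    B.rOperator W u x = 0 := by
  simp [InvariantInnerProduct.rOperator, projPerp_of_mem B hx]

/-- The equation that determines `r` on `W^⊥`; later computations use it in place of the inverse. -/
theorem rOperator_sub {u : G} (hA : ∀ w ∈ B.perp W, lieAd u w ∈ B.perp W)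
    (hu : IsUnit (B.onPerp W (lieAd u - 1))) {w : GroupLieAlgebra (𝓡 n) G}
    (hw : w ∈ B.perp W) :
    B.rOperator W u (lieAd u w - w) = -(1 / 2 : ℝ) • (lieAd u w + w) := by
  have h1 : B.projPerp W (lieAd u w - w) = B.onPerp W (lieAd u - 1) ⟨w, hw⟩ := rfl
  have h2 : Ring.inverse (B.onPerp W (lieAd u - 1)) (B.onPerp W (lieAd u - 1) ⟨w, hw⟩) =
      ⟨w, hw⟩ := by
    rw [← Module.End.mul_apply, Ring.inverse_mul_cancel _ hu, Module.End.one_apply]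
  have h3 : B.onPerp W (lieAd u + 1) ⟨w, hw⟩ = B.projPerp W (lieAd u w + w) := rfl
  rw [InvariantInnerProduct.rOperator, LinearMap.smul_apply, LinearMap.comp_apply,
    LinearMap.comp_apply, h1, Module.End.mul_apply, h2, h3, Submodule.subtype_apply,
    projPerp_of_mem_perp B ((B.perp W).add_mem (hA w hw) hw)]

end Projections

/-! ### Invertibility of `Ad_u - 1` on `𝔥^⊥` and smoothness of `r`. -/

section SliceOperators

variable {n : ℕ} {G : Type*} [TopologicalSpace G] [ChartedSpace (EuclideanSpace ℝ (Fin n)) G]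
  [Group G] [LieGroup (𝓡 n) ∞ G] (B : InvariantInnerProduct n G) {g : G} {U : Set G}

theorem lieAd_sub_self_mem_perp {K : Subgroup G} {u : G} (hu : u ∈ K)
    {w : GroupLieAlgebra (𝓡 n) G} (hw : w ∈ B.perp (subgroupLie K)) :
    lieAd u w - w ∈ B.perp (subgroupLie K) :=
  Submodule.sub_mem _ (lieAd_mem_perp B hu hw) hw

/-- At a point `u` of a slice, `Ad_u - 1` is invertible on the orthogonal complement of the Lie
algebra of the stabilizer. -/
theorem bijOn_lieAd_sub_self (hU : IsConjSlice (n := n) g U) {u : G} (hu : u ∈ U) :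
    Set.BijOn (fun ξ : GroupLieAlgebra (𝓡 n) G => lieAd u ξ - ξ)
      (B.perp (subgroupLie (stab g)) : Set (GroupLieAlgebra (𝓡 n) G))
      (B.perp (subgroupLie (stab g)) : Set (GroupLieAlgebra (𝓡 n) G)) := by
  have hus : u ∈ stab g := hU.subset_stab hu
  have hsurj : Set.SurjOn (fun ξ : GroupLieAlgebra (𝓡 n) G => lieAd u ξ - ξ)
      (B.perp (subgroupLie (stab g)) : Set (GroupLieAlgebra (𝓡 n) G))
      (B.perp (subgroupLie (stab g)) : Set (GroupLieAlgebra (𝓡 n) G)) := by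
    intro ζ hζ
    -- This target is chosen so that applying `Ad_u` gives `ζ = Ad_u ξ - ξ - Ad_u η`; the preimage
    -- of `ζ` is then the `𝔥^⊥` component of `ξ`.
    obtain ⟨ξ, η, hη, h⟩ := exists_add_eq_of_isConjSlice hU hu (-lieAd u⁻¹ ζ)
    have h' := congrArg (lieAd u) h
    simp only [map_add, map_sub, map_neg, lieAd_lieAd_inv] at h'
    set x := B.proj (subgroupLie (stab g)) ξ with hx
    have hxm : x ∈ subgroupLie (stab g) := proj_mem B _ ξ
    have hwm : ξ - x ∈ B.perp (subgroupLie (stab g)) := sub_proj_mem B _ ξ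
    refine ⟨ξ - x, hwm, ?_⟩
    -- The left side lies in `𝔥^⊥` and the right side in `𝔥`, so both vanish.
    have e : lieAd u (ξ - x) - (ξ - x) - ζ = lieAd u η - (lieAd u x - x) := by
      rw [map_sub]
      linear_combination (norm := module) (-1 : ℝ) • h'
    have h0 := eq_zero_of_mem_of_mem_perp B (W := subgroupLie (stab g))
      (x := lieAd u (ξ - x) - (ξ - x) - ζ)
      (by
        rw [e]
        exact Submodule.sub_mem _ (lieAd_mem_subgroupLie hus hη)
          (Submodule.sub_mem _ (lieAd_mem_subgroupLie hus hxm) hxm))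
      (Submodule.sub_mem _ (lieAd_sub_self_mem_perp B hus hwm) hζ)
    exact sub_eq_zero.1 h0
  refine ⟨fun w hw => lieAd_sub_self_mem_perp B hus hw, ?_, hsurj⟩
  intro x hx y hy hxy
  have hd : x - y ∈ B.perp (subgroupLie (stab g)) := Submodule.sub_mem _ hx hy
  -- A vector fixed by the isometry `Ad_u` is orthogonal to the range of `Ad_u - 1`; by surjectivity
  -- `x - y` also lies in that range, hence is orthogonal to itself.
  have hfix : lieAd u (x - y) = x - y := by
    have : lieAd u x - x = lieAd u y - y := hxy
    rw [map_sub, ← sub_eq_zero, sub_sub_sub_comm, this, sub_self]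
  obtain ⟨s, -, hs⟩ := hsurj hd
  by_contra hne
  refine (B.pos (x - y) (sub_ne_zero.2 hne)).ne' ?_
  have hs' : lieAd u s - s = x - y := hs
  have h1 : B.form (x - y) (lieAd u s) = B.form (x - y) s := by
    rw [← hfix, B.invariant u, hfix]
  calc B.form (x - y) (x - y) = B.form (x - y) (lieAd u s - s) := by rw [hs']
    _ = 0 := by rw [map_sub, h1, sub_self]

/-- The change of variables that clears the denominator of `r`. -/
theorem exists_eq_add_lieAd_sub_self (hU : IsConjSlice (n := n) g U) {u : G} (hu : u ∈ U)
    (x : GroupLieAlgebra (𝓡 n) G) :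
    ∃ x₀ ∈ subgroupLie (n := n) (stab g), ∃ a ∈ B.perp (subgroupLie (stab g)),
      x = x₀ + (lieAd u a - a) := by
  obtain ⟨a, ha, h⟩ := (bijOn_lieAd_sub_self B hU hu).surjOn
    (sub_proj_mem B (subgroupLie (stab g)) x)
  refine ⟨_, proj_mem B (subgroupLie (stab g)) x, a, ha, ?_⟩
  have h' : lieAd u a - a = x - B.proj (subgroupLie (stab g)) x := h
  rw [h', add_sub_cancel]

theorem isUnit_onPerp (hU : IsConjSlice (n := n) g U) {u : G} (hu : u ∈ U) :
    IsUnit (B.onPerp (subgroupLie (stab g)) (lieAd u - 1)) := by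
  have hus : u ∈ stab g := hU.subset_stab hu
  have hval (w : B.perp (subgroupLie (stab g))) :
      ((B.onPerp (subgroupLie (stab g)) (lieAd u - 1) w : B.perp (subgroupLie (stab g))) :
        GroupLieAlgebra (𝓡 n) G) =
      lieAd u (w : GroupLieAlgebra (𝓡 n) G) - (w : GroupLieAlgebra (𝓡 n) G) :=
    projPerp_of_mem_perp B (lieAd_sub_self_mem_perp B hus w.2)
  have hb := bijOn_lieAd_sub_self B hU hu
  rw [Module.End.isUnit_iff]
  constructor
  · intro x y hxy
    refine Subtype.ext (hb.injOn x.2 y.2 ?_)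
    exact (hval x).symm.trans ((congrArg Subtype.val hxy).trans (hval y))
  · intro y
    obtain ⟨w, hw, h⟩ := hb.surjOn y.2
    exact ⟨⟨w, hw⟩, Subtype.ext ((hval ⟨w, hw⟩).trans h)⟩

/-- The orthogonal projection as a continuous linear map of the model space. -/
def projL (W : Submodule ℝ (GroupLieAlgebra (𝓡 n) G)) :
    EuclideanSpace ℝ (Fin n) →L[ℝ] EuclideanSpace ℝ (Fin n) :=
  LinearMap.toContinuousLinearMap (E := EuclideanSpace ℝ (Fin n))
    (F' := EuclideanSpace ℝ (Fin n)) (B.proj W)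

theorem isUnit_conjDeriv_sub_one (hU : IsConjSlice (n := n) g U) {u : G} (hu : u ∈ U) :
    IsUnit ((conjDeriv n u - 1) * (1 - projL B (subgroupLie (stab g))) +
      projL B (subgroupLie (stab g))) := by
  have hus : u ∈ stab g := hU.subset_stab hu
  have hN (x : GroupLieAlgebra (𝓡 n) G) :
      ((conjDeriv n u - 1) * (1 - projL B (subgroupLie (stab g))) +
        projL B (subgroupLie (stab g))) x =
      lieAd u (x - B.proj (subgroupLie (stab g)) x) - (x - B.proj (subgroupLie (stab g)) x) +
        B.proj (subgroupLie (stab g)) x := rfl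
  rw [ContinuousLinearMap.isUnit_iff_bijective]
  have hsurj : Function.Surjective (DFunLike.coe ((conjDeriv n u - 1) *
      (1 - projL B (subgroupLie (stab g))) + projL B (subgroupLie (stab g)))) := by
    intro x
    obtain ⟨x₀, hx₀, a, ha, h⟩ := exists_eq_add_lieAd_sub_self B hU hu x
    refine ⟨(x₀ + a : GroupLieAlgebra (𝓡 n) G), (hN _).trans ?_⟩
    rw [map_add, proj_of_mem B hx₀, proj_of_mem_perp B ha, add_zero, add_sub_cancel_left, h,
      add_comm]
  exact ⟨LinearMap.injective_iff_surjective.2 hsurj, hsurj⟩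

/-- On a slice, the operator `r` is the Cayley transform of the adjoint representation. -/
theorem rOperator_eq_cayleyExt (hU : IsConjSlice (n := n) g U) {u : G} (hu : u ∈ U)
    (x : GroupLieAlgebra (𝓡 n) G) :
    B.rOperator (subgroupLie (stab g)) u x =
      cayleyExt (projL B (subgroupLie (stab g))) (conjDeriv n u) x := by
  have hus : u ∈ stab g := hU.subset_stab hu
  obtain ⟨x₀, hx₀, a, ha, rfl⟩ := exists_eq_add_lieAd_sub_self B hU hu x
  rw [map_add, rOperator_of_mem B u hx₀, rOperator_sub B (fun w hw => lieAd_mem_perp B hus hw)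
    (isUnit_onPerp B hU hu) ha, zero_add]
  have h := cayleyExt_apply (isUnit_conjDeriv_sub_one B hU hu)
    (x₀ + a : GroupLieAlgebra (𝓡 n) G)
  have hp : B.proj (subgroupLie (stab g)) (x₀ + a) = x₀ := by
    rw [map_add, proj_of_mem B hx₀, proj_of_mem_perp B ha, add_zero]
  have h' : cayleyExt (projL B (subgroupLie (stab g))) (conjDeriv n u)
      (lieAd u (x₀ + a - B.proj (subgroupLie (stab g)) (x₀ + a)) -
        (x₀ + a - B.proj (subgroupLie (stab g)) (x₀ + a)) +
        B.proj (subgroupLie (stab g)) (x₀ + a) : GroupLieAlgebra (𝓡 n) G) =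
      (-(1 / 2 : ℝ) • (lieAd u (x₀ + a - B.proj (subgroupLie (stab g)) (x₀ + a)) +
        (x₀ + a - B.proj (subgroupLie (stab g)) (x₀ + a))) : GroupLieAlgebra (𝓡 n) G) := h
  rw [hp, add_sub_cancel_left, add_comm _ x₀] at h'
  exact h'.symm

/-- Smoothness holds at `u` in the ambient group: this function is a local smooth extension of `r`,
with which it is identified on `U`. -/
theorem contMDiffAt_cayleyExt (hU : IsConjSlice (n := n) g U) {u : G} (hu : u ∈ U) :
    ContMDiffAt (𝓡 n) 𝓘(ℝ, EuclideanSpace ℝ (Fin n) →L[ℝ] EuclideanSpace ℝ (Fin n)) ∞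
      (fun k : G => cayleyExt (projL B (subgroupLie (stab g))) (conjDeriv n k)) u :=
  (contDiffAt_cayleyExt (isUnit_conjDeriv_sub_one B hU hu)).contMDiffAt.comp u
    (contMDiff_conjDeriv u)

/-- The functional `B(x, ·)` on the model space. -/
def formL (x : GroupLieAlgebra (𝓡 n) G) : EuclideanSpace ℝ (Fin n) →L[ℝ] ℝ :=
  LinearMap.toContinuousLinearMap (show EuclideanSpace ℝ (Fin n) →ₗ[ℝ] ℝ from B.form x)

/-- The matrix coefficient of an operator, as a continuous linear functional of the operator. -/
def coeffL (x y : GroupLieAlgebra (𝓡 n) G) :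
    (EuclideanSpace ℝ (Fin n) →L[ℝ] EuclideanSpace ℝ (Fin n)) →L[ℝ] ℝ :=
  (formL B x).comp
    (ContinuousLinearMap.apply ℝ (EuclideanSpace ℝ (Fin n)) (show EuclideanSpace ℝ (Fin n) from y))

theorem contMDiffOn_r (hU : IsConjSlice (n := n) g U) {ι : Type*}
    (e : ι → GroupLieAlgebra (𝓡 n) G) (a b : ι) :
    ContMDiffOn (𝓡 n) 𝓘(ℝ, ℝ) ∞ (B.r e (subgroupLie (stab g)) a b) U := by
  intro u hu
  have h := (coeffL B (e a) (e b)).contDiff.contMDiff.contMDiffAt.comp u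
    (contMDiffAt_cayleyExt B hU hu)
  refine h.contMDiffWithinAt.congr (fun k hk => ?_) ?_
  · exact congrArg (B.form (e a)) (rOperator_eq_cayleyExt B hU hk (e b))
  · exact congrArg (B.form (e a)) (rOperator_eq_cayleyExt B hU hu (e b))

end SliceOperators

/-! ### Derivatives along the slice. -/

section DerivativeAlongSlice

open Topology

/-- `U` may have smaller dimension than `M`, so `mfderivWithin` need not be unique. Its value on the
velocity of a curve in `U` is nevertheless forced by the chain rule. -/
theorem hasDerivAt_comp_of_mdifferentiableWithinAt {n : ℕ} {M : Type*} [TopologicalSpace M]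
    [ChartedSpace (EuclideanSpace ℝ (Fin n)) M] {U : Set M} {f : M → ℝ} {c : ℝ → M} {u : M}
    (hf : MDifferentiableWithinAt (𝓡 n) 𝓘(ℝ, ℝ) f U u)
    (hc : MDifferentiableAt 𝓘(ℝ, ℝ) (𝓡 n) c 0) (h0 : c 0 = u)
    (hU : ∀ᶠ t in 𝓝 (0 : ℝ), c t ∈ U) :
    HasDerivAt (f ∘ c)
      ((mfderivWithin (𝓡 n) 𝓘(ℝ, ℝ) f U u : EuclideanSpace ℝ (Fin n) →L[ℝ] ℝ)
        (mfderiv 𝓘(ℝ, ℝ) (𝓡 n) c 0 (1 : ℝ) : EuclideanSpace ℝ (Fin n))) 0 := by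
  subst h0
  have h := (HasMFDerivWithinAt.comp (0 : ℝ) hf.hasMFDerivWithinAt
    (hc.hasMFDerivAt.hasMFDerivWithinAt (s := c ⁻¹' U)) subset_rfl).hasMFDerivAt hU
  have aux (L₁ : EuclideanSpace ℝ (Fin n) →L[ℝ] ℝ) (L₂ : ℝ →L[ℝ] EuclideanSpace ℝ (Fin n))
      (h : HasFDerivAt (f ∘ c) (L₁.comp L₂) 0) : HasDerivAt (f ∘ c) (L₁ (L₂ 1)) 0 :=
    h.hasDerivAt
  exact aux _ _ (hasMFDerivAt_iff_hasFDerivAt.1 h)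

variable {n : ℕ} {G : Type*} [TopologicalSpace G] [ChartedSpace (EuclideanSpace ℝ (Fin n)) G]
  [Group G] [LieGroup (𝓡 n) ∞ G]

/-- The derivative of a function on `U` along a left-invariant vector which is tangent to `U`. -/
theorem hasDerivAt_derivAlong {U : Set G} {f : G → ℝ} {u : G}
    (hf : MDifferentiableWithinAt (𝓡 n) 𝓘(ℝ, ℝ) f U u) {γ : ℝ → G}
    {η : GroupLieAlgebra (𝓡 n) G} (hγ : HasVelocityAtOne γ η)
    (hU : ∀ᶠ t in 𝓝 (0 : ℝ), u * γ t ∈ U) :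
    HasDerivAt (fun t => f (u * γ t)) (derivAlong U f u (mulInvariantVectorField η u)) 0 := by
  have hL := mdifferentiableAt_mul_left (n := n) u (1 : G)
  have hc := MDifferentiableAt.comp_of_eq (0 : ℝ) hL hγ.mdifferentiableAt hγ.map_zero
  have h := hasDerivAt_comp_of_mdifferentiableWithinAt hf hc (by simp [hγ.map_zero]) hU
  have hv := mfderiv_comp_apply_of_base_eq hL hγ.mdifferentiableAt hγ.map_zero (1 : ℝ)
  rw [hγ.mfderiv_eq] at hv
  rw [hv] at h
  exact h

/-- Left translation by `u⁻¹` sends `x^L` to `x` and `x^R` to `Ad_{u⁻¹} x`. -/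
theorem tangentProj_half_add (B : InvariantInnerProduct n G)
    (W : Submodule ℝ (GroupLieAlgebra (𝓡 n) G)) (u : G) (x : GroupLieAlgebra (𝓡 n) G) :
    B.tangentProj W u
        ((1 / 2 : ℝ) • (mulInvariantVectorField x u + rightInvariantVectorField x u)) =
      mulInvariantVectorField (B.proj W ((1 / 2 : ℝ) • (x + lieAd u⁻¹ x))) u := by
  have hLi := mdifferentiableAt_mul_left (n := n) u⁻¹ u
  have hL := mdifferentiableAt_mul_left (n := n) u 1
  have hR := mdifferentiableAt_mul_right (n := n) u 1
  have h1 := mfderiv_comp_apply_of_base_eq hLi hL (mul_one u) x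
  have h2 := mfderiv_comp_apply_of_base_eq hLi hR (one_mul u) x
  have e1 : (fun z : G => u⁻¹ * z) ∘ (fun z : G => u * z) = id := by ext; simp
  have e2 : (fun z : G => u⁻¹ * z) ∘ (fun z : G => z * u) = fun z => u⁻¹ * z * u⁻¹⁻¹ := by
    ext; simp [mul_assoc]
  rw [e1, mfderiv_id] at h1
  rw [e2] at h2
  let T : TangentSpace (𝓡 n) u →ₗ[ℝ] GroupLieAlgebra (𝓡 n) G :=
    ContinuousLinearMap.toLinearMap (M := EuclideanSpace ℝ (Fin n))
      (M₂ := EuclideanSpace ℝ (Fin n)) (mfderiv (𝓡 n) (𝓡 n) (fun z : G => u⁻¹ * z) u)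
  have key : T ((1 / 2 : ℝ) • (mulInvariantVectorField x u + rightInvariantVectorField x u)) =
      (1 / 2 : ℝ) • (x + lieAd u⁻¹ x) := by
    have h1' : T (mulInvariantVectorField x u) = x := h1.symm
    have h2' : T (rightInvariantVectorField x u) = lieAd u⁻¹ x := h2.symm
    rw [map_smul, map_add, h1', h2']
  exact congrArg (fun v => mulInvariantVectorField (B.proj W v) u) key

/-- The derivative of `r` along a slice. -/
theorem exists_hasDerivAt_cayleyExt (B : InvariantInnerProduct n G) {g : G} {U : Set G}
    (hU : IsConjSlice (n := n) g U) {u : G} (hu : u ∈ U) {γ : ℝ → G}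
    {η : GroupLieAlgebra (𝓡 n) G} (hγ : HasVelocityAtOne γ η)
    (hγU : ∀ᶠ t in 𝓝 (0 : ℝ), u * γ t ∈ U) :
    ∃ R' : EuclideanSpace ℝ (Fin n) →L[ℝ] EuclideanSpace ℝ (Fin n),
      HasDerivAt (fun t => cayleyExt (projL B (subgroupLie (stab g))) (conjDeriv n (u * γ t)))
        R' 0 ∧
      (∀ x ∈ subgroupLie (n := n) (stab g), R' x = 0) ∧
      ∀ w ∈ B.perp (subgroupLie (stab g)), ∀ s ∈ B.perp (subgroupLie (stab g)),
        lieAd u s - s = lieAd u ⁅η, w⁆ → R' (lieAd u w - w : GroupLieAlgebra (𝓡 n) G) = s := by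
  have hL := mdifferentiableAt_mul_left (n := n) u (1 : G)
  have hc := MDifferentiableAt.comp_of_eq (0 : ℝ) hL hγ.mdifferentiableAt hγ.map_zero
  have hR₀ := hasDerivAt_comp_curve
    ((contMDiffAt_cayleyExt B hU hu).mdifferentiableAt (by simp)) hc (by simp [hγ.map_zero])
  obtain ⟨R', hR⟩ : ∃ R' : EuclideanSpace ℝ (Fin n) →L[ℝ] EuclideanSpace ℝ (Fin n),
      HasDerivAt (fun t => cayleyExt (projL B (subgroupLie (stab g))) (conjDeriv n (u * γ t)))
        R' 0 :=
    ⟨_, hR₀⟩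
  have hRv (f : ℝ → EuclideanSpace ℝ (Fin n)) (v : EuclideanSpace ℝ (Fin n))
      (hf : HasDerivAt f v 0) := hR.clm_apply hf
  have hs (k : G) (hk : k ∈ U) (w : GroupLieAlgebra (𝓡 n) G)
      (hw : w ∈ B.perp (subgroupLie (stab g))) :
      cayleyExt (projL B (subgroupLie (stab g))) (conjDeriv n k)
        (lieAd k w - w : GroupLieAlgebra (𝓡 n) G) =
      (-(1 / 2 : ℝ) • (lieAd k w + w) : GroupLieAlgebra (𝓡 n) G) :=
    (rOperator_eq_cayleyExt B hU hk _).symm.trans (rOperator_sub B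
      (fun w hw => lieAd_mem_perp B (hU.subset_stab hk) hw) (isUnit_onPerp B hU hk) hw)
  have hu0 : u * γ 0 = u := by rw [hγ.map_zero, mul_one]
  refine ⟨R', hR, ?_, ?_⟩
  · intro x hx
    have h1 := hRv (fun _ => x) 0 (hasDerivAt_const _ _)
    have h2 : HasDerivAt (fun _ : ℝ => (0 : EuclideanSpace ℝ (Fin n))) 0 0 := hasDerivAt_const _ _
    have h3 := h1.unique (h2.congr_of_eventuallyEq (by
      filter_upwards [hγU] with t ht
      exact (rOperator_eq_cayleyExt B hU ht x).symm.trans (rOperator_of_mem B _ hx)))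
    rwa [map_zero, add_zero] at h3
  · intro w hw s hsm h
    have hAw := hγ.hasDerivAt_lieAd u w
    have hA (v : EuclideanSpace ℝ (Fin n)) (A : ℝ → EuclideanSpace ℝ (Fin n))
        (A' : EuclideanSpace ℝ (Fin n)) (hA : HasDerivAt A A' 0) :
        HasDerivAt (fun t => A t - v) A' 0 ∧
          HasDerivAt (fun t => -(1 / 2 : ℝ) • (A t + v)) (-(1 / 2 : ℝ) • A') 0 :=
      ⟨hA.sub_const v, (hA.add_const v).const_smul (-(1 / 2 : ℝ))⟩
    obtain ⟨h1, h2⟩ := hA w _ _ hAw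
    -- The equation `r (Ad w - w) = -½ (Ad w + w)` holds along the curve and is differentiated by
    -- the product rule. Substituting `Ad_u ⁅η, w⁆ = Ad_u s - s` into `R'(Ad_u w - w) + r(Ad_u ⁅η,
    -- w⁆) = -½ Ad_u ⁅η, w⁆` leaves `s`.
    have h3 := (hRv _ _ h1).unique (h2.congr_of_eventuallyEq (by
      filter_upwards [hγU] with t ht
      exact hs _ ht w hw))
    have h4 : (R' (lieAd (u * γ 0) w - w : GroupLieAlgebra (𝓡 n) G) +
        cayleyExt (projL B (subgroupLie (stab g))) (conjDeriv n (u * γ 0)) (lieAd u ⁅η, w⁆) :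
          EuclideanSpace ℝ (Fin n)) = (-(1 / 2 : ℝ) • lieAd u ⁅η, w⁆ : GroupLieAlgebra (𝓡 n) G) := h3
    have key (p q r : GroupLieAlgebra (𝓡 n) G) (h : p + -(1 / 2 : ℝ) • (q + r) =
        -(1 / 2 : ℝ) • (q - r)) : p = r := by
      linear_combination (norm := module) h
    rw [hu0, ← h, hs u hu s hsm] at h4
    exact key _ _ _ h4

end DerivativeAlongSlice

/-! ### The multilinear identity. -/

section CyclicIdentity

/-- Let `α, β, γ` be `A` acting in the three slots. The part without `x, y, z` rests on
`(α-1)(β-1)(γ-1) + (α+1)(β-1)(γ+1) + (α+1)(β+1)(γ-1) + (α-1)(β+1)(γ+1) = 4(αβγ - 1)`, which `hA`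
kills. The part linear in `x` is `½(1 + βγ) - ¼(β+1)(γ+1) = ¼(β-1)(γ-1)`. -/
theorem cyclic_sum_eq {V : Type*} [AddCommGroup V] [Module ℝ V]
    (Φ : V →ₗ[ℝ] V →ₗ[ℝ] V →ₗ[ℝ] ℝ) (A : V →ₗ[ℝ] V) {x y z a b c : V}
    (hA : Φ (A a) (A b) (A c) = Φ a b c)
    (h₁ : Φ x y c = 0) (h₁' : Φ x y (A c) = 0) (h₂ : Φ x b z = 0) (h₂' : Φ x (A b) z = 0)
    (h₃ : Φ a y z = 0) (h₃' : Φ (A a) y z = 0) :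
    (1 / 2 * (Φ x b c + Φ x (A b) (A c)) - 1 / 4 * Φ (A a + a) (y + (A b - b)) (A c + c)) +
      (1 / 2 * (Φ a y c + Φ (A a) y (A c)) - 1 / 4 * Φ (A a + a) (A b + b) (z + (A c - c))) +
      (1 / 2 * (Φ a b z + Φ (A a) (A b) z) - 1 / 4 * Φ (x + (A a - a)) (A b + b) (A c + c)) =
    1 / 4 * (Φ (x + (A a - a)) (y + (A b - b)) (z + (A c - c)) - Φ x y z) := by
  simp only [map_add, map_sub, LinearMap.add_apply, LinearMap.sub_apply]
  linear_combination (-1) * hA + (1 / 4) * (h₁ - h₁' + h₂ - h₂' + h₃ - h₃')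

end CyclicIdentity

/-! ### The invariant three-form and the terms of the Yang-Baxter equation. -/

section DynamicalYangBaxter

open Topology

variable {n : ℕ} {G : Type*} [TopologicalSpace G] [ChartedSpace (EuclideanSpace ℝ (Fin n)) G]
  [Group G] [LieGroup (𝓡 n) ∞ G] (B : InvariantInnerProduct n G)

/-- The invariant trilinear form `B(x, [y, z])`. -/
def triForm : GroupLieAlgebra (𝓡 n) G →ₗ[ℝ] GroupLieAlgebra (𝓡 n) G →ₗ[ℝ]
    GroupLieAlgebra (𝓡 n) G →ₗ[ℝ] ℝ :=
  LinearMap.mk₂ ℝ (fun x y => B.form x ∘ₗ lieBracketₗ n G y)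
    (fun x₁ x₂ y => by ext; simp) (fun c x y => by ext; simp)
    (fun x y₁ y₂ => by ext; simp) (fun c x y => by ext; simp)

theorem triForm_apply (x y z : GroupLieAlgebra (𝓡 n) G) :
    triForm B x y z = B.form x ⁅y, z⁆ := rfl

theorem triForm_swap_right (x y z : GroupLieAlgebra (𝓡 n) G) :
    triForm B x y z = -triForm B x z y := by
  have := congrArg (B.form x) (lieBracketₗ_skew y z)
  rwa [map_neg] at this

theorem triForm_swap_left (x y z : GroupLieAlgebra (𝓡 n) G) :
    triForm B x y z = -triForm B y x z := by
  have h1 := form_bracket B y x z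
  have h2 : B.form ⁅y, x⁆ z = -triForm B z x y := by
    rw [B.symm, ← triForm_apply, triForm_swap_right]
  have h3 := form_bracket B x z y
  have h4 : B.form ⁅x, z⁆ y = triForm B y x z := B.symm _ _
  simp only [← triForm_apply] at h1 h3 h2 h4 ⊢
  rw [h2] at h1
  rw [h4] at h3
  linarith

theorem triForm_rotate (x y z : GroupLieAlgebra (𝓡 n) G) :
    triForm B x y z = triForm B y z x := by
  rw [triForm_swap_left, triForm_swap_right, neg_neg]

theorem triForm_lieAd (u : G) (x y z : GroupLieAlgebra (𝓡 n) G) :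
    triForm B (lieAd u x) (lieAd u y) (lieAd u z) = triForm B x y z := by
  rw [triForm_apply, ← lieAd_bracket, B.invariant, triForm_apply]

/-- Bracketing with the Lie algebra of `K` preserves its orthogonal complement. -/
theorem triForm_eq_zero {K : Subgroup G} {x y w : GroupLieAlgebra (𝓡 n) G}
    (hx : x ∈ subgroupLie K) (hy : y ∈ subgroupLie K) (hw : w ∈ B.perp (subgroupLie K)) :
    triForm B x y w = 0 :=
  form_eq_zero B hx (bracket_mem_perp B hy hw)

variable {g : G} {U : Set G}

theorem rOperator_add_lieAd_sub_self (hU : IsConjSlice (n := n) g U) {u : G} (hu : u ∈ U)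
    {x a : GroupLieAlgebra (𝓡 n) G} (hx : x ∈ subgroupLie (stab g))
    (ha : a ∈ B.perp (subgroupLie (stab g))) :
    B.rOperator (subgroupLie (stab g)) u (x + (lieAd u a - a)) =
      -(1 / 2 : ℝ) • (lieAd u a + a) := by
  rw [map_add, rOperator_of_mem B u hx, zero_add, rOperator_sub B
    (fun w hw => lieAd_mem_perp B (hU.subset_stab hu) hw) (isUnit_onPerp B hU hu) ha]

/-- The operator `r` is antisymmetric. -/
theorem form_rOperator (hU : IsConjSlice (n := n) g U) {u : G} (hu : u ∈ U)
    (x y : GroupLieAlgebra (𝓡 n) G) :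
    B.form x (B.rOperator (subgroupLie (stab g)) u y) =
      -B.form (B.rOperator (subgroupLie (stab g)) u x) y := by
  have hus : u ∈ stab g := hU.subset_stab hu
  obtain ⟨x₀, hx₀, a, ha, rfl⟩ := exists_eq_add_lieAd_sub_self B hU hu x
  obtain ⟨y₀, hy₀, b, hb, rfl⟩ := exists_eq_add_lieAd_sub_self B hU hu y
  rw [rOperator_add_lieAd_sub_self B hU hu hx₀ ha, rOperator_add_lieAd_sub_self B hU hu hy₀ hb]
  have h1 := form_eq_zero B hx₀ hb
  have h2 := form_eq_zero B hx₀ (lieAd_mem_perp B hus hb)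
  have h3 := (B.symm a y₀).trans (form_eq_zero B hy₀ ha)
  have h4 := (B.symm (lieAd u a) y₀).trans (form_eq_zero B hy₀ (lieAd_mem_perp B hus ha))
  have h5 := B.invariant u a b
  simp only [map_add, map_sub, map_smul, LinearMap.add_apply, LinearMap.sub_apply,
    LinearMap.smul_apply, smul_eq_mul, h1, h2, h3, h4, h5]
  ring

/-- The minus sign comes from antisymmetry, which moves `r` onto `e i`. -/
theorem sum_r_mul_f_mul_r {ι : Type*} [Fintype ι] [DecidableEq ι]
    (e : Module.Basis ι ℝ (GroupLieAlgebra (𝓡 n) G))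
    (he : ∀ a b, B.form (e a) (e b) = if a = b then 1 else 0)
    (hU : IsConjSlice (n := n) g U) {u : G} (hu : u ∈ U) (i j k : ι) :
    ∑ p, ∑ q, B.r e (subgroupLie (stab g)) i p u * B.f e p j q *
        B.r e (subgroupLie (stab g)) q k u =
      -triForm B (B.rOperator (subgroupLie (stab g)) u (e i)) (e j)
        (B.rOperator (subgroupLie (stab g)) u (e k)) := by
  set R := B.rOperator (subgroupLie (stab g)) u with hR
  have h1 (p : ι) : ∑ q, B.r e (subgroupLie (stab g)) i p u * B.f e p j q *
      B.r e (subgroupLie (stab g)) q k u =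
      B.form (e i) (R (e p)) * B.form (e p) ⁅e j, R (e k)⁆ := by
    rw [← triForm_apply, ← sum_form_mul_form B e he (triForm B (e p) (e j)) (R (e k)),
      Finset.mul_sum]
    exact Finset.sum_congr rfl fun q _ => mul_assoc _ _ _
  rw [Finset.sum_congr rfl fun p _ => h1 p]
  rw [triForm_apply, ← form_rOperator B hU hu]
  exact sum_form_mul_form B e he (B.form (e i) ∘ₗ R) ⁅e j, R (e k)⁆

/-- The direction is `η = ½ (x + Ad_{u⁻¹} x)`, and the derivative comes out as `Φ(η,b,c)` with `Φ =
triForm B`; moving `Ad_{u⁻¹}` off `x` by invariance gives the two terms. -/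
theorem derivAlong_r {ι : Type*} (e : ι → GroupLieAlgebra (𝓡 n) G)
    (hU : IsConjSlice (n := n) g U) {u : G} (hu : u ∈ U) {x y z a b c : GroupLieAlgebra (𝓡 n) G}
    (hx : x ∈ subgroupLie (stab g)) (hy : y ∈ subgroupLie (stab g))
    (hz : z ∈ subgroupLie (stab g)) (ha : a ∈ B.perp (subgroupLie (stab g)))
    (hc : c ∈ B.perp (subgroupLie (stab g)))
    {i j k : ι} (hi : e i = x + (lieAd u a - a)) (hj : e j = y + (lieAd u b - b))
    (hk : e k = z + (lieAd u c - c)) :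
    derivAlong U (B.r e (subgroupLie (stab g)) j k) u
        (B.tangentProj (subgroupLie (stab g)) u ((1 / 2 : ℝ) •
          (mulInvariantVectorField (e i) u + rightInvariantVectorField (e i) u))) =
      1 / 2 * (triForm B x b c + triForm B x (lieAd u b) (lieAd u c)) := by
  have hus : u ∈ stab g := hU.subset_stab hu
  have hus' : u⁻¹ ∈ stab g := (stab g).inv_mem hus
  set η : GroupLieAlgebra (𝓡 n) G := (1 / 2 : ℝ) • (x + lieAd u⁻¹ x) with hη
  have hηm : η ∈ subgroupLie (n := n) (stab g) :=
    Submodule.smul_mem _ _ (Submodule.add_mem _ hx (lieAd_mem_subgroupLie hus' hx))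
  have hp : B.proj (subgroupLie (stab g)) ((1 / 2 : ℝ) • (e i + lieAd u⁻¹ (e i))) = η := by
    have h1 := proj_of_mem_perp B (lieAd_mem_perp B hus ha)
    have h2 := proj_of_mem_perp B ha
    have h3 := proj_of_mem_perp B (lieAd_mem_perp B hus' ha)
    have h4 := proj_of_mem B hx
    have h5 := proj_of_mem B (lieAd_mem_subgroupLie hus' hx)
    simp only [hi, map_smul, map_add, map_sub, lieAd_inv_lieAd, h1, h2, h3, h4, h5, sub_zero,
      add_zero, hη]
  rw [tangentProj_half_add, hp]
  obtain ⟨γ, hγ, hγs⟩ := isVelocityAtOne_iff.1 hηm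
  have hγU : ∀ᶠ t in 𝓝 (0 : ℝ), u * γ t ∈ U := by
    obtain ⟨V, hV, hUV⟩ := hU.open_in_stab
    have hcont : ContinuousAt (fun t => u * γ t) 0 :=
      ContinuousAt.comp_of_eq (f := γ)
        (contMDiff_mul_left (I := 𝓡 n) (n := ∞) (a := u)).continuous.continuousAt
        hγ.contMDiffAt.continuousAt hγ.map_zero
    have huV : u * γ 0 ∈ V := by
      rw [hγ.map_zero, mul_one]
      rw [hUV] at hu
      exact hu.1
    filter_upwards [hcont.eventually (hV.mem_nhds huV), hγs] with t ht ht'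
    rw [hUV]
    exact ⟨ht, (stab g).mul_mem hus ht'⟩
  obtain ⟨R', hR', hR'0, hR's⟩ := exists_hasDerivAt_cayleyExt B hU hu hγ hγU
  have h1 := hasDerivAt_derivAlong
    ((contMDiffOn_r B hU e j k u hu).mdifferentiableWithinAt (by simp)) hγ hγU
  have h2 := (coeffL B (e j) (e k)).hasFDerivAt.comp_hasDerivAt 0 hR'
  have h3 := h1.unique (h2.congr_of_eventuallyEq (by
    filter_upwards [hγU] with t ht
    exact congrArg (B.form (e j)) (rOperator_eq_cayleyExt B hU ht (e k))))
  rw [h3]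
  -- This `s` is the derivative of `r` applied to `e k`. Pairing it with `Ad_u b - b` gives `b ·
  -- (Ad_{u⁻¹} s - s) = -b · ⁅η, c⁆`, while the `𝔥` component `y` of `e j` is orthogonal to `s`.
  obtain ⟨s, hs, hsc⟩ := (bijOn_lieAd_sub_self B hU hu).surjOn
    (lieAd_mem_perp B hus (bracket_mem_perp B hηm hc))
  have hsc' : lieAd u s - s = lieAd u ⁅η, c⁆ := hsc
  have hRk : R' (z + (lieAd u c - c) : GroupLieAlgebra (𝓡 n) G) = s := by
    have h : R' (z + (lieAd u c - c) : GroupLieAlgebra (𝓡 n) G) =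
      R' z + R' (lieAd u c - c : GroupLieAlgebra (𝓡 n) G) := R'.map_add z _
    rw [h, hR'0 z hz, zero_add]
    exact hR's c hc s hs hsc'
  have h4 : coeffL B (e j) (e k) R' = B.form (e j) s := by
    rw [← hRk, ← hk]
    rfl
  have h5 : s - lieAd u⁻¹ s = ⁅η, c⁆ := by
    have := congrArg (lieAd u⁻¹) hsc'
    rwa [map_sub, lieAd_inv_lieAd, lieAd_inv_lieAd] at this
  have h6 : B.form (e j) s = -triForm B b η c := by
    rw [triForm_apply, ← h5, hj, map_add, LinearMap.add_apply, form_eq_zero B hy hs, map_sub,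
      LinearMap.sub_apply, form_lieAd_left, map_sub]
    ring
  rw [h4, h6, ← triForm_swap_left, hη, map_smul, map_add, LinearMap.smul_apply,
    LinearMap.add_apply, LinearMap.smul_apply, LinearMap.add_apply, smul_eq_mul,
    ← triForm_lieAd B u (lieAd u⁻¹ x), lieAd_lieAd_inv]

end DynamicalYangBaxter

end LieGroup

end


theorem lemma8p2 {n : ℕ} {G : Type*} [TopologicalSpace G]
    [ChartedSpace (EuclideanSpace ℝ (Fin n)) G] [Group G] [LieGroup (𝓡 n) ∞ G]
    [T2Space G] [CompactSpace G]
    (B : InvariantInnerProduct n G)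
    {ι : Type*} [Fintype ι] [DecidableEq ι] (e : Module.Basis ι ℝ (GroupLieAlgebra (𝓡 n) G))
    (he : ∀ a b, B.form (e a) (e b) = if a = b then 1 else 0)
    (g : G) (U : Set G) (hU : IsConjSlice (n := n) g U)
    (𝔥 : Submodule ℝ (GroupLieAlgebra (𝓡 n) G)) (h𝔥 : 𝔥 = subgroupLie (stab g)) :
    -- the quotient `(Ad_u + 1)/(Ad_u - 1)` on `𝔥^⊥` makes sense
    (∀ u ∈ U, Set.BijOn (fun ξ : GroupLieAlgebra (𝓡 n) G => lieAd u ξ - ξ)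
      (B.perp 𝔥 : Set (GroupLieAlgebra (𝓡 n) G)) (B.perp 𝔥 : Set (GroupLieAlgebra (𝓡 n) G))) ∧
    -- `r` is smooth on `U`
    (∀ a b, ContMDiffOn (𝓡 n) 𝓘(ℝ, ℝ) ∞ (B.r e 𝔥 a b) U) ∧
    -- the generalized classical dynamical Yang-Baxter equation
    ∀ u ∈ U, ∀ a b c,
      cycl (fun a b c =>
          derivAlong U (B.r e 𝔥 b c) u
            (B.tangentProj 𝔥 u
              ((1 / 2 : ℝ) • (mulInvariantVectorField (e a) u + rightInvariantVectorField (e a) u)))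
          + ∑ k, ∑ l, B.r e 𝔥 a k u * B.f e k b l * B.r e 𝔥 l c u) a b c
        = 1 / 4 * (B.f e a b c - B.fSub e 𝔥 a b c) := by
  subst h𝔥
  refine ⟨fun u hu => LieGroup.bijOn_lieAd_sub_self B hU hu,
    fun a b => LieGroup.contMDiffOn_r B hU e a b, ?_⟩
  intro u hu i j k
  have hus : u ∈ stab g := hU.subset_stab hu
  obtain ⟨x, hx, a, ha, hi⟩ := LieGroup.exists_eq_add_lieAd_sub_self B hU hu (e i)
  obtain ⟨y, hy, b, hb, hj⟩ := LieGroup.exists_eq_add_lieAd_sub_self B hU hu (e j)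
  obtain ⟨z, hz, c, hc, hk⟩ := LieGroup.exists_eq_add_lieAd_sub_self B hU hu (e k)
  have ha' := LieGroup.lieAd_mem_perp B hus ha
  have hb' := LieGroup.lieAd_mem_perp B hus hb
  have hc' := LieGroup.lieAd_mem_perp B hus hc
  have hpx : B.proj (subgroupLie (stab g)) (e i) = x := by
    rw [hi, map_add, map_sub, LieGroup.proj_of_mem B hx, LieGroup.proj_of_mem_perp B ha,
      LieGroup.proj_of_mem_perp B ha', sub_zero, add_zero]
  have hpy : B.proj (subgroupLie (stab g)) (e j) = y := by
    rw [hj, map_add, map_sub, LieGroup.proj_of_mem B hy, LieGroup.proj_of_mem_perp B hb,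
      LieGroup.proj_of_mem_perp B hb', sub_zero, add_zero]
  have hpz : B.proj (subgroupLie (stab g)) (e k) = z := by
    rw [hk, map_add, map_sub, LieGroup.proj_of_mem B hz, LieGroup.proj_of_mem_perp B hc,
      LieGroup.proj_of_mem_perp B hc', sub_zero, add_zero]
  -- The six vanishing hypotheses are the values with two entries in `𝔥` and one in `𝔥^⊥`, rotated
  -- where the latter is not last.
  have key := LieGroup.cyclic_sum_eq (LieGroup.triForm B) (lieAd u) (x := x) (y := y) (z := z)
    (LieGroup.triForm_lieAd B u a b c)
    (LieGroup.triForm_eq_zero B hx hy hc) (LieGroup.triForm_eq_zero B hx hy hc')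
    (by rw [← LieGroup.triForm_rotate, LieGroup.triForm_eq_zero B hz hx hb])
    (by rw [← LieGroup.triForm_rotate, LieGroup.triForm_eq_zero B hz hx hb'])
    (by rw [LieGroup.triForm_rotate, LieGroup.triForm_eq_zero B hy hz ha])
    (by rw [LieGroup.triForm_rotate, LieGroup.triForm_eq_zero B hy hz ha'])
  have hRi := LieGroup.rOperator_add_lieAd_sub_self B hU hu hx ha
  have hRj := LieGroup.rOperator_add_lieAd_sub_self B hU hu hy hb
  have hRk := LieGroup.rOperator_add_lieAd_sub_self B hU hu hz hc
  rw [← hi] at hRi key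
  rw [← hj] at hRj key
  rw [← hk] at hRk key
  have hquad (v w : GroupLieAlgebra (𝓡 n) G) (d : GroupLieAlgebra (𝓡 n) G) :
      -LieGroup.triForm B (-(1 / 2 : ℝ) • v) d (-(1 / 2 : ℝ) • w) =
        -(1 / 4 * LieGroup.triForm B v d w) := by
    simp only [map_smul, LinearMap.smul_apply, smul_eq_mul]
    ring
  simp only [cycl]
  -- The closing rotations bring the cyclically permuted terms to the slot order used in `key`.
  rw [LieGroup.sum_r_mul_f_mul_r B e he hU hu, LieGroup.sum_r_mul_f_mul_r B e he hU hu,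
    LieGroup.sum_r_mul_f_mul_r B e he hU hu,
    LieGroup.derivAlong_r B e hU hu hx hy hz ha hc hi hj hk,
    LieGroup.derivAlong_r B e hU hu hy hz hx hb ha hj hk hi,
    LieGroup.derivAlong_r B e hU hu hz hx hy hc hb hk hi hj, hRi, hRj, hRk,
    hquad, hquad, hquad, InvariantInnerProduct.f, InvariantInnerProduct.fSub, hpx, hpy, hpz,
    ← LieGroup.triForm_apply, ← LieGroup.triForm_apply, ← key,
    ← LieGroup.triForm_rotate B a y c, ← LieGroup.triForm_rotate B (lieAd u a) y (lieAd u c),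
    LieGroup.triForm_rotate B z a b, LieGroup.triForm_rotate B z (lieAd u a) (lieAd u b),
    ← LieGroup.triForm_rotate B (lieAd u a + a) (lieAd u b + b) (e k),
    LieGroup.triForm_rotate B (lieAd u c + c) (e i) (lieAd u b + b)]
  ring
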